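/- **Trees.** An *effective tree* is a diagram of finite sets $E\xleftarrow{s}M\xrightarrow{p}N\xrightarrow{t}E$ (edges, nodes with a marked input edge, nodes) with $t$ injective, $s$ injective with complement a single edge (the *root*), such that the walk $s(m)\mapsto t(p(m))$ started at any edge reaches the root after finitely many steps, and with $p$ surjective (no nullary nodes). With isomorphisms of diagrams, effective trees form a groupoid $\mathbf T$. The *leaves* of $T$ are the edges not in the image of $t$; the leaf set is never empty, and this gives the *leaf map* $L:\mathbf T\to\mathbf B$ to the groupoid $\mathbf B$ of non-empty finite sets and bijections. A *cut* $c$ of $T$ is a subtree $S_c\subset T$ which contains the root and, with each of its nodes, all input edges of that node; $\delta_{P_c}$ denotes the product of the $\delta_{T_e}$ over the leaves $e$ of $S_c$, where $T_e\subset T$ is the subtree of all edges and nodes above $e$ (with root $e$). **Bialgebras.** Let $\mathcal F=\mathbb Q[[A_1,A_2,\dots]]$, $a_n=A_n/n!$ and $A=\sum_{n\ge1}a_n$, with $\Delta(a_n)$ the coefficient of $z^n$ in the composite $g\circ f$ of $f(z)=\sum_{k\geq 1} (a_k\otimes 1)z^k$ and $g(z)=\sum_{k\geq 1}(1\otimes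 a_k)z^k$, and with $\varepsilon(a_n)$ the coefficient of $z^n$ in the series $z$ (the completed non-reduced classical Faà di Bruno bialgebra). Let $\mathcal B_{\mathrm{eff}}=\mathbb Q[[\delta_T]]_{T\in\pi_0\mathbf T}$, with $\Delta(\delta_T)=\sum_c\delta_{P_c}\otimes\delta_{S_c}$ (sum over the cuts of $T$), $\varepsilon(\delta_T)=1$ if $T$ has no nodes and $\varepsilon(\delta_T)=0$ otherwise (the completed bialgebra of effective trees). The comultiplications are extended to continuous algebra homomorphisms into the completed tensor squares, that is, the power series rings in two disjoint copies of the variables. The counit is defined on those power series, in particular on all polynomials, of which only finitely many terms have non-zero counit. Put $$G=\sum_{T\in\pi_0\mathbf T}\frac{\delta_T}{|\mathrm{Aut}\,T|},\qquad g_n=\sum_{T\in\pi_0\mathbf T,\ |L(T)|=n}\frac{\delta_T}{|\mathrm{Aut}\,T|},\qquad G_n=\sum_{T\in\pi_0({}_n\mathbf T)}\frac{\delta_T}{|\mathrm{Aut}_n T|},$$ where ${}_n\mathbf T$ is the homotopy fibre of $L$ over the set $n=\{1,\dots,n\}$ and $\mathrm{Aut}_n$ denotes automorphisms in it. **The map $\Phi$.**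 For a morphism of groupoids $q:X\to Y$ with finite homotopy fibres $X_y$, let $|X|_Y=\sum_{y\in\pi_0Y}\frac{|X_y|}{|\mathrm{Aut}(y)|}\,\delta_y$, where $|X_y|$ is groupoid cardinality; for $Y=\mathbf B$ write $\delta_n=A_n$. Let $\Phi:\mathcal F\to\mathcal B_{\mathrm{eff}}$ be the continuous algebra homomorphism that sends $A_n$ to the relative cardinality over $\mathbf T$ of the homotopy pullback along $L$ of the morphism $1\to\mathbf B$ picking out the set $n$. **Lemma.** (i) For every morphism of groupoids $X\to\mathbf B$ with finite homotopy fibres, the homotopy pullback $L^*X\to\mathbf T$ has finite homotopy fibres, and $\Phi(|X|_{\mathbf B})=|L^*X|_{\mathbf T}$. (ii) $\Phi(A_n)=G_n$ and $\Phi(a_n)=g_n$ for all $n\ge1$, and $\Phi(A)=G$. (iii) $\Phi$ is a bialgebra homomorphism: it is an algebra homomorphism, $\Delta\circ\Phi=(\Phi\otimes\Phi)\circ\Delta$ on $\mathcal F$, and $\Phi$ preserves counits: for $f\in\mathcal F$, the counit of $f$ is defined if and only if that of $\Phi(f)$ is, and then $\varepsilon(\Phi(f))=\varepsilon(f)$;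 for every polynomial $f$ both are defined. -/

import Mathlib

open CategoryTheory CategoryTheory.Limits

universe u v

noncomputable section

namespace FdB

/-! ### Groupoids, homotopy fibres and groupoid cardinality -/

/-- The set of isomorphism classes of objects. -/
abbrev Pi0 (C : Type*) [Category C] := Quotient (isIsomorphicSetoid C)

/-- The isomorphism class of an object. -/
def cls {C : Type*} [Category C] (x : C) : Pi0 C := Quotient.mk (isIsomorphicSetoid C) x

/-- A finite groupoid: finitely many isomorphism classes and finite vertex groups. -/
def IsFiniteGroupoid (C : Type*) [Category C] : Prop :=
  Finite (Pi0 C) ∧ ∀ x : C, Finite (Aut x)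

/-- Groupoid (homotopy) cardinality. -/
def groupoidCard (C : Type*) [Category C] : ℚ :=
  ∑ᶠ x : Pi0 C, 1 / (Nat.card (Aut x.out) : ℚ)

/-- The homotopy fibre of `p` over `b`: its objects are pairs `(x, φ : p x ≅ b)`.  As the target is
a groupoid, every arrow `p x ⟶ b` is an isomorphism. -/
abbrev HFibre {X B : Type*} [Category X] [Groupoid B] (p : X ⥤ B) (b : B) :=
  CostructuredArrow p b

/-- A morphism of groupoids is finite when all its homotopy fibres are finite. -/
def FiniteFibres {X B : Type*} [Category X] [Groupoid B] (p : X ⥤ B) : Prop :=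
  ∀ b : B, IsFiniteGroupoid (HFibre p b)

/-- Relative cardinality of `p : X ⥤ B`, as a function on isomorphism classes of `B`. -/
def relCard {X B : Type*} [Category X] [Groupoid B] (p : X ⥤ B) (b : Pi0 B) : ℚ :=
  groupoidCard (HFibre p b.out) / (Nat.card (Aut b.out) : ℚ)

/-! ### The groupoid of non-empty finite sets -/

/-- A non-empty finite set. -/
structure FinSet where
  carrier : Type
  [fin : Finite carrier]
  [ne : Nonempty carrier]

attribute [instance] FinSet.fin FinSet.ne

instance : Groupoid FinSet where
  Hom X Y := X.carrier ≃ Y.carrier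
  id X := Equiv.refl X.carrier
  comp f g := f.trans g
  inv f := f.symm
  inv_comp f := Equiv.symm_trans_self f
  comp_inv f := Equiv.self_trans_symm f

/-- The standard set with `n ≥ 1` elements. -/
def stdSet (n : ℕ+) : FinSet where
  carrier := Fin n
  ne := ⟨⟨0, n.pos⟩⟩

/-! ### Effective operadic trees -/

/-- One step of the walk towards the root in a diagram `E ← M → N → E`. -/
def Step {E M N : Type} (s : M → E) (p : M → N) (t : N → E) (x y : E) : Prop :=
  ∃ m, s m = x ∧ t (p m) = y

/-- An effective tree: a diagram of finite sets `E ←s M →p N →t E` (edges, nodes with a marked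
input edge, nodes) with `t` injective, `s` injective with singleton complement (the root), such
that the walk towards the root from any edge reaches the root, and without nullary nodes. -/
structure EffTree where
  E : Type
  M : Type
  N : Type
  [finE : Finite E]
  [finM : Finite M]
  [finN : Finite N]
  s : M → E
  p : M → N
  t : N → E
  root : E
  t_inj : Function.Injective t
  s_inj : Function.Injective s
  range_s : Set.range s = {root}ᶜ
  reaches : ∀ e, Relation.ReflTransGen (Step s p t) e root
  p_surj : Function.Surjective p

attribute [instance] EffTree.finE EffTree.finM EffTree.finN

namespace EffTree

/-- An isomorphism of trees. -/
@[ext]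
structure Iso (T U : EffTree) where
  onE : T.E ≃ U.E
  onM : T.M ≃ U.M
  onN : T.N ≃ U.N
  comm_s : ∀ m, onE (T.s m) = U.s (onM m)
  comm_p : ∀ m, onN (T.p m) = U.p (onM m)
  comm_t : ∀ n, onE (T.t n) = U.t (onN n)

/-- The groupoid of effective trees. -/
instance : Groupoid EffTree where
  Hom T U := Iso T U
  id T := ⟨Equiv.refl _, Equiv.refl _, Equiv.refl _, fun _ => rfl, fun _ => rfl, fun _ => rfl⟩
  comp f g := ⟨f.onE.trans g.onE, f.onM.trans g.onM, f.onN.trans g.onN,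
    fun m => by simp [f.comm_s, g.comm_s], fun m => by simp [f.comm_p, g.comm_p],
    fun n => by simp [f.comm_t, g.comm_t]⟩
  inv f := ⟨f.onE.symm, f.onM.symm, f.onN.symm,
    fun m => by simp [Equiv.symm_apply_eq, f.comm_s],
    fun m => by simp [Equiv.symm_apply_eq, f.comm_p],
    fun n => by simp [Equiv.symm_apply_eq, f.comm_t]⟩
  inv_comp f := by apply Iso.ext <;> simp
  comp_inv f := by apply Iso.ext <;> simp

variable (T : EffTree)

/-- One step towards the root. -/
abbrev Stp (x y : T.E) : Prop := Step T.s T.p T.t x y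

/-- `x` lies (weakly) above `e`: the walk from `x` to the root passes through `e`. -/
def Above (x e : T.E) : Prop := Relation.ReflTransGen T.Stp x e

variable {T}

lemma step_functional {x y z : T.E} (h : T.Stp x y) (h' : T.Stp x z) : y = z := by
  obtain ⟨m, rfl, rfl⟩ := h
  obtain ⟨m', hm, rfl⟩ := h'
  rw [T.s_inj hm]

lemma s_ne_root (m : T.M) : T.s m ≠ T.root := by
  have h : T.s m ∈ Set.range T.s := ⟨m, rfl⟩
  rw [T.range_s] at h
  exact h

lemma exists_s {e : T.E} (h : e ≠ T.root) : ∃ m, T.s m = e := by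
  have h' : e ∈ Set.range T.s := by rw [T.range_s]; exact h
  exact h'

lemma acyclic (x : T.E) : ¬ Relation.TransGen T.Stp x x := by
  intro hx
  have key : ∀ y, Relation.ReflTransGen T.Stp x y → Relation.TransGen T.Stp y y := by
    intro y hy
    induction hy with
    | refl => exact hx
    | tail _ hstep ih =>
      obtain ⟨c, hc, hc'⟩ := Relation.TransGen.head'_iff.1 ih
      have := step_functional hc hstep
      subst this
      exact Relation.TransGen.tail'_iff.2 ⟨_, hc', hc⟩
  obtain ⟨c, ⟨m, hm, _⟩, _⟩ := Relation.TransGen.head'_iff.1 (key _ (T.reaches x))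
  exact s_ne_root m hm

/-- The leaves: the edges which are not the output edge of any node. -/
def leaves (T : EffTree) : Set T.E := (Set.range T.t)ᶜ

lemma leaves_nonempty (T : EffTree) : Nonempty T.leaves := by
  have hwf : WellFounded (Relation.TransGen T.Stp) :=
    haveI : Std.Irrefl (Relation.TransGen T.Stp) := ⟨acyclic⟩
    Finite.wellFounded_of_trans_of_irrefl _
  obtain ⟨e, -, he⟩ := hwf.has_min Set.univ ⟨T.root, trivial⟩
  refine ⟨e, ?_⟩
  rintro ⟨n, rfl⟩
  obtain ⟨m, rfl⟩ := T.p_surj n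
  exact he (T.s m) trivial (.single ⟨m, rfl, rfl⟩)

/-- The set of leaves, as an object of the groupoid of non-empty finite sets. -/
def leafSet (T : EffTree) : FinSet where
  carrier := T.leaves
  ne := T.leaves_nonempty

lemma Iso.mem_leaves {T U : EffTree} (f : Iso T U) (e : T.E) :
    e ∈ T.leaves ↔ f.onE e ∈ U.leaves := by
  refine not_congr ⟨?_, ?_⟩
  · rintro ⟨n, rfl⟩
    exact ⟨f.onN n, (f.comm_t n).symm⟩
  · rintro ⟨n, hn⟩
    refine ⟨f.onN.symm n, f.onE.injective ?_⟩
    rw [f.comm_t, Equiv.apply_symm_apply, hn]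

/-- The leaf map from effective trees to non-empty finite sets. -/
def leafMap : EffTree ⥤ FinSet where
  obj T := T.leafSet
  map {T U} f := Equiv.subtypeEquiv (Iso.onE f) (Iso.mem_leaves f)
  map_id T := by apply Equiv.ext; intro x; rfl
  map_comp f g := by apply Equiv.ext; intro x; rfl

/-- A cut: a subtree containing the root.  It consists of a set of edges and a set of nodes; the
marked input edges of the subtree are all those of its nodes (the inclusion preserves arities), and
every edge of the subtree other than the root is an input edge of a node of the subtree. -/
structure Cut (T : EffTree) where
  edges : Set T.E
  nodes : Set T.N
  root_mem : T.root ∈ edges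
  out_mem : ∀ n ∈ nodes, T.t n ∈ edges
  in_mem_iff : ∀ m, T.s m ∈ edges ↔ T.p m ∈ nodes

/-- The tree `S_c` below a cut. -/
def Cut.below (c : T.Cut) : EffTree where
  E := c.edges
  M := {m : T.M // T.p m ∈ c.nodes}
  N := c.nodes
  s m := ⟨T.s m.1, (c.in_mem_iff m.1).2 m.2⟩
  p m := ⟨T.p m.1, m.2⟩
  t n := ⟨T.t n.1, c.out_mem n.1 n.2⟩
  root := ⟨T.root, c.root_mem⟩
  t_inj a b h := Subtype.ext (T.t_inj (Subtype.ext_iff.1 h))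
  s_inj a b h := Subtype.ext (T.s_inj (Subtype.ext_iff.1 h))
  range_s := by
    ext ⟨e, he⟩
    constructor
    · rintro ⟨m, hm⟩ h
      rw [Set.mem_singleton_iff.1 h] at hm
      exact s_ne_root m.1 (Subtype.ext_iff.1 hm)
    · intro h
      obtain ⟨m, rfl⟩ := exists_s (T := T) (e := e) fun h' => h (Subtype.ext h')
      exact ⟨⟨m, (c.in_mem_iff m).1 he⟩, rfl⟩
  reaches := by
    rintro ⟨e, he⟩
    induction T.reaches e using Relation.ReflTransGen.head_induction_on with
    | refl => exact .refl
    | head h _ ih =>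
      obtain ⟨m, rfl, rfl⟩ := h
      have hm := (c.in_mem_iff m).1 he
      exact .head ⟨⟨m, hm⟩, rfl, rfl⟩ (ih (c.out_mem _ hm))
  p_surj := by
    rintro ⟨n, hn⟩
    obtain ⟨m, rfl⟩ := T.p_surj n
    exact ⟨⟨m, hn⟩, rfl⟩

/-- The ideal subtree generated by an edge `e`: all edges and nodes above `e`. -/
def ideal (T : EffTree) (e : T.E) : EffTree where
  E := {x // T.Above x e}
  M := {m : T.M // T.Above (T.t (T.p m)) e}
  N := {n : T.N // T.Above (T.t n) e}
  s m := ⟨T.s m.1, .head ⟨m.1, rfl, rfl⟩ m.2⟩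
  p m := ⟨T.p m.1, m.2⟩
  t n := ⟨T.t n.1, n.2⟩
  root := ⟨e, .refl⟩
  t_inj a b h := Subtype.ext (T.t_inj (Subtype.ext_iff.1 h))
  s_inj a b h := Subtype.ext (T.s_inj (Subtype.ext_iff.1 h))
  range_s := by
    ext ⟨x, hx⟩
    constructor
    · rintro ⟨⟨m, hm⟩, hmx⟩ h
      rw [Set.mem_singleton_iff.1 h] at hmx
      have hme : T.s m = e := Subtype.ext_iff.1 hmx
      exact acyclic e (Relation.TransGen.head'_iff.2 ⟨_, ⟨m, hme, rfl⟩, hm⟩)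
    · intro h
      rcases Relation.ReflTransGen.cases_head hx with h' | ⟨y, ⟨m, rfl, rfl⟩, hy⟩
      · exact absurd (Subtype.ext h') h
      · exact ⟨⟨m, hy⟩, rfl⟩
  reaches := by
    rintro ⟨x, hx⟩
    induction hx using Relation.ReflTransGen.head_induction_on with
    | refl => exact .refl
    | head h h' ih =>
      obtain ⟨m, rfl, rfl⟩ := h
      exact .head ⟨⟨m, h'⟩, rfl, rfl⟩ ih
  p_surj := by
    rintro ⟨n, hn⟩
    obtain ⟨m, rfl⟩ := T.p_surj n
    exact ⟨⟨m, hn⟩, rfl⟩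

instance : Finite T.Cut :=
  Finite.of_injective (fun c : T.Cut => (c.edges, c.nodes)) fun c d h => by
    cases c; cases d; simp_all

end EffTree

/-! ### Power series -/

/-- The degree-one power series `∑ i, c i • X i` in possibly infinitely many variables. -/
def linSeries {σ : Type*} (c : σ → ℚ) : MvPowerSeries σ ℚ :=
  open Classical in fun d => ∑ i ∈ d.support, if d = Finsupp.single i 1 then c i else 0

lemma coeff_linSeries_single {σ : Type*} (c : σ → ℚ) (i : σ) :
    MvPowerSeries.coeff (Finsupp.single i 1) (linSeries c) = c i := by
  classical
  change ∑ j ∈ (Finsupp.single i 1).support, _ = _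
  rw [Finsupp.support_single _ one_ne_zero]
  simp

lemma exists_of_coeff_linSeries {σ : Type*} {c : σ → ℚ} {d : σ →₀ ℕ}
    (h : MvPowerSeries.coeff d (linSeries c) ≠ 0) : ∃ i, d = Finsupp.single i 1 ∧ c i ≠ 0 := by
  classical
  change (∑ j ∈ d.support, _) ≠ 0 at h
  obtain ⟨i, -, hi⟩ := Finset.exists_ne_zero_of_sum_ne_zero h
  by_cases hd : d = Finsupp.single i 1
  · exact ⟨i, hd, by simpa [hd] using hi⟩
  · simp [hd] at hi

/-- The power series ring in two disjoint copies of the variables: the completed tensor product of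
the ring of power series in the variables `σ` with itself. -/
abbrev TensorSq (σ : Type*) := MvPowerSeries (σ ⊕ σ) ℚ

instance {σ τ : Type*} : Filter.TendstoCofinite (Sum.inl : σ → σ ⊕ τ) :=
  Filter.tendstoCofinite_of_injective Sum.inl_injective

instance {σ τ : Type*} : Filter.TendstoCofinite (Sum.inr : τ → σ ⊕ τ) :=
  Filter.tendstoCofinite_of_injective Sum.inr_injective

/-- The family `Φ(X i) ⊗ 1`, `1 ⊗ Φ(X i)`. -/
def tensorFamily {σ τ : Type*} (a : σ → MvPowerSeries τ ℚ) : σ ⊕ σ → TensorSq τ :=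
  Sum.elim (fun i => MvPowerSeries.rename Sum.inl (a i))
    (fun i => MvPowerSeries.rename Sum.inr (a i))

lemma exists_of_coeff_rename {σ τ : Type*} (f : σ → τ) [Filter.TendstoCofinite f]
    {p : MvPowerSeries σ ℚ} {d : τ →₀ ℕ}
    (h : MvPowerSeries.coeff d (MvPowerSeries.rename f p) ≠ 0) :
    ∃ e, Finsupp.mapDomain f e = d ∧ MvPowerSeries.coeff e p ≠ 0 := by
  rw [MvPowerSeries.coeff_rename] at h
  obtain ⟨e, he, he'⟩ := Finset.exists_ne_zero_of_sum_ne_zero h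
  exact ⟨e, by simpa using he, he'⟩

lemma hasSubst_tensorFamily {σ τ : Type*} {a : σ → MvPowerSeries τ ℚ}
    (ha : MvPowerSeries.HasSubst a) : MvPowerSeries.HasSubst (tensorFamily a) where
  const_coeff s := by
    rcases s with i | i <;> simpa [tensorFamily] using ha.const_coeff i
  coeff_zero d := by
    have key : ∀ (f : τ → τ ⊕ τ) [Filter.TendstoCofinite f],
        {i | MvPowerSeries.coeff d (MvPowerSeries.rename f (a i)) ≠ 0}.Finite := by
      intro f _
      refine Set.Finite.subset (Set.Finite.biUnion
        (Filter.TendstoCofinite.finite_preimage_singleton (Finsupp.mapDomain f) d)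
        fun e _ => ha.coeff_zero e) ?_
      intro i hi
      obtain ⟨e, he, he'⟩ := exists_of_coeff_rename f hi
      exact Set.mem_biUnion (x := e) he he'
    refine Set.Finite.subset (((key Sum.inl).image Sum.inl).union ((key Sum.inr).image Sum.inr)) ?_
    rintro (i | i) hi
    · exact Or.inl ⟨i, hi, rfl⟩
    · exact Or.inr ⟨i, hi, rfl⟩

/-- For the continuous algebra homomorphism `Φ` with `Φ(X i) = a i`, the homomorphism `Φ ⊗ Φ`
of completed tensor squares. -/
def tensorHom {σ τ : Type*} {a : σ → MvPowerSeries τ ℚ} (ha : MvPowerSeries.HasSubst a) :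
    TensorSq σ →ₐ[ℚ] TensorSq τ :=
  MvPowerSeries.substAlgHom (hasSubst_tensorFamily ha)

/-- The value of the counit on a power series: `CounitValue ε f r` says that, `ε` being the values of
the counit on the variables, only finitely many terms of `f` have non-zero counit, and that the
sum of their counits is `r`. -/
def CounitValue {σ : Type*} (ε : σ → ℚ) (f : MvPowerSeries σ ℚ) (r : ℚ) : Prop :=
  (Function.support fun d : σ →₀ ℕ =>
    MvPowerSeries.coeff d f * d.prod fun i k => ε i ^ k).Finite ∧
  ∑ᶠ d : σ →₀ ℕ, (MvPowerSeries.coeff d f * d.prod fun i k => ε i ^ k) = r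

/-! ### The Faà di Bruno bialgebra -/

/-- The completed Faà di Bruno algebra `ℚ[[A₁, A₂, …]]`. -/
abbrev FaaDiBruno := MvPowerSeries ℕ+ ℚ

/-- The generator `A_n`. -/
def bigA (n : ℕ+) : FaaDiBruno := MvPowerSeries.X n

/-- `a_n = A_n / n!`. -/
def smallA (n : ℕ+) : FaaDiBruno := (1 / ((n : ℕ).factorial : ℚ)) • bigA n

/-- `A = ∑ A_n / n!`. -/
def totalA : FaaDiBruno := linSeries fun n : ℕ+ => 1 / ((n : ℕ).factorial : ℚ)

/-- The generic series `∑_{n ≥ 1} a_n z ^ n`, with the `a_n` taken in the copy `ι` of the variables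
(`Sum.inl`: the elements `a_n ⊗ 1`; `Sum.inr`: the elements `1 ⊗ a_n`). -/
def genericSeries (ι : ℕ+ → ℕ+ ⊕ ℕ+) : PowerSeries (TensorSq ℕ+) :=
  PowerSeries.mk fun n => if h : 0 < n then
    (1 / (n.factorial : ℚ)) • (MvPowerSeries.X (ι ⟨n, h⟩) : TensorSq ℕ+) else 0

/-- `Δ(A_n) = n! Δ(a_n)`, where `Δ(a_n)` is the coefficient of `z ^ n` in the composite `g ∘ f` of
the generic series `f = ∑ (a_n ⊗ 1) z ^ n` and `g = ∑ (1 ⊗ a_n) z ^ n`. -/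
def faaComulGen (n : ℕ+) : TensorSq ℕ+ :=
  ((n : ℕ).factorial : ℚ) • PowerSeries.coeff (n : ℕ)
    (PowerSeries.subst (genericSeries Sum.inl) (genericSeries Sum.inr))

/-- Power series in two copies of the variables whose monomials all have weight `n`, where
`A_m ⊗ 1` has weight `m` and `1 ⊗ A_m` has weight `0`. -/
def HasWeight (n : ℕ) (f : TensorSq ℕ+) : Prop :=
  ∀ d, MvPowerSeries.coeff d f ≠ 0 → Finsupp.weight (Sum.elim (fun m : ℕ+ => (m : ℕ)) 0) d = n

lemma HasWeight.mul {m n : ℕ} {f g : TensorSq ℕ+} (hf : HasWeight m f) (hg : HasWeight n g) :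
    HasWeight (m + n) (f * g) := by
  classical
  intro d hd
  rw [MvPowerSeries.coeff_mul] at hd
  obtain ⟨⟨a, b⟩, hab, h⟩ := Finset.exists_ne_zero_of_sum_ne_zero hd
  rw [← Finset.HasAntidiagonal.mem_antidiagonal.1 hab, map_add, hf a (left_ne_zero_of_mul h),
    hg b (right_ne_zero_of_mul h)]

lemma HasWeight.sum {ι : Type*} {n : ℕ} {s : Finset ι} {f : ι → TensorSq ℕ+}
    (hf : ∀ i ∈ s, HasWeight n (f i)) : HasWeight n (∑ i ∈ s, f i) := by
  intro d hd
  rw [map_sum] at hd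
  obtain ⟨i, hi, h⟩ := Finset.exists_ne_zero_of_sum_ne_zero hd
  exact hf i hi d h

lemma HasWeight.smul {n : ℕ} {f : TensorSq ℕ+} (hf : HasWeight n f) (r : ℚ) :
    HasWeight n (r • f) := by
  intro d hd
  rw [MvPowerSeries.coeff_smul] at hd
  exact hf d (right_ne_zero_of_mul hd)

lemma HasWeight.zero (n : ℕ) : HasWeight n 0 := fun d hd => absurd (by simp) hd

lemma hasWeight_X (i : ℕ+ ⊕ ℕ+) :
    HasWeight (Sum.elim (fun m : ℕ+ => (m : ℕ)) 0 i) (MvPowerSeries.X i) := by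
  classical
  intro d hd
  rw [MvPowerSeries.coeff_X] at hd
  have : d = Finsupp.single i 1 := by
    by_contra h
    simp [h] at hd
  rw [this, Finsupp.weight_single, one_smul]

lemma hasWeight_genericSeries_inl (n : ℕ) :
    HasWeight n (PowerSeries.coeff n (genericSeries Sum.inl)) := by
  rw [genericSeries, PowerSeries.coeff_mk]
  split_ifs with h
  · exact (hasWeight_X (Sum.inl ⟨n, h⟩)).smul _
  · exact .zero _

lemma hasWeight_genericSeries_inr (n : ℕ) :
    HasWeight 0 (PowerSeries.coeff n (genericSeries Sum.inr)) := by
  rw [genericSeries, PowerSeries.coeff_mk]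
  split_ifs with h
  · exact (hasWeight_X (Sum.inr ⟨n, h⟩)).smul _
  · exact .zero _

lemma hasWeight_genericSeries_pow (k n : ℕ) :
    HasWeight n (PowerSeries.coeff n (genericSeries Sum.inl ^ k)) := by
  classical
  induction k generalizing n with
  | zero =>
    rw [pow_zero, PowerSeries.coeff_one]
    split_ifs with h
    · intro d hd
      rw [MvPowerSeries.coeff_one] at hd
      have : d = 0 := by
        by_contra h
        simp [h] at hd
      rw [this, h, map_zero]
    · exact .zero _
  | succ k ih =>
    rw [pow_succ, PowerSeries.coeff_mul]
    refine .sum fun ij hij => ?_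
    rw [← Finset.HasAntidiagonal.mem_antidiagonal.1 hij]
    exact (ih _).mul (hasWeight_genericSeries_inl _)

lemma hasSubst_genericSeries (ι : ℕ+ → ℕ+ ⊕ ℕ+) : PowerSeries.HasSubst (genericSeries ι) := by
  apply PowerSeries.HasSubst.of_constantCoeff_zero'
  rw [← PowerSeries.coeff_zero_eq_constantCoeff_apply, genericSeries, PowerSeries.coeff_mk]
  simp

lemma hasWeight_faaComulGen (n : ℕ+) : HasWeight n (faaComulGen n) := by
  apply HasWeight.smul
  rw [PowerSeries.coeff_subst' (hasSubst_genericSeries _),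
    finsum_eq_sum _ (PowerSeries.coeff_subst_finite' (hasSubst_genericSeries _) _ _)]
  refine .sum fun k _ => ?_
  have := (hasWeight_genericSeries_inr k).mul (hasWeight_genericSeries_pow k n)
  rwa [zero_add] at this

lemma hasSubst_faaComulGen : MvPowerSeries.HasSubst faaComulGen where
  const_coeff n := by
    have : MvPowerSeries.constantCoeff (faaComulGen n) = 0 := by
      by_contra h
      exact n.ne_zero (by simpa using (hasWeight_faaComulGen n 0 h).symm)
    rw [this]
    exact IsNilpotent.zero
  coeff_zero d := by
    apply Set.Subsingleton.finite
    intro m hm n hn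
    exact PNat.coe_injective
      ((hasWeight_faaComulGen m d hm).symm.trans (hasWeight_faaComulGen n d hn))

/-- The comultiplication of the completed Faà di Bruno bialgebra: the continuous algebra
homomorphism with the given values on the generators. -/
def faaComul : FaaDiBruno →ₐ[ℚ] TensorSq ℕ+ :=
  MvPowerSeries.substAlgHom hasSubst_faaComulGen

/-- The counit on generators: `ε(A_n) = n! ε(a_n)`, with `ε(a_n)` the coefficient of `z ^ n` in
the identity series `z`. -/
def faaCounitGen (n : ℕ+) : ℚ :=
  ((n : ℕ).factorial : ℚ) * PowerSeries.coeff (n : ℕ) (PowerSeries.X : PowerSeries ℚ)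

/-! ### The bialgebra of effective trees -/

/-- The completed algebra `ℚ[[δ_T]]` of effective trees. -/
abbrev TreeAlg := MvPowerSeries (Pi0 EffTree) ℚ

/-- The comultiplication on generators, `Δ(δ_T) = ∑_c δ_{P_c} ⊗ δ_{S_c}`, the sum being over the
cuts `c` of `T`; here `δ_{P_c}` is the product of the `δ` of the ideal subtrees of `T` generated
by the leaves of `S_c`. -/
def treeComulGen (x : Pi0 EffTree) : TensorSq (Pi0 EffTree) :=
  ∑ᶠ c : x.out.Cut,
    (∏ᶠ e : c.below.leaves,
      (MvPowerSeries.X (Sum.inl (cls (x.out.ideal e.1.1))) : TensorSq (Pi0 EffTree))) *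
    MvPowerSeries.X (Sum.inr (cls c.below))

lemma cls_eq_iff {x : Pi0 EffTree} {T : EffTree} : cls T = x ↔ Nonempty (EffTree.Iso T x.out) := by
  constructor
  · rintro rfl
    obtain ⟨i⟩ := (Quotient.mk_out (s := isIsomorphicSetoid EffTree) T)
    exact ⟨i.inv⟩
  · rintro ⟨i⟩
    rw [← Quotient.out_eq x]
    exact Quotient.sound ⟨(asIso (C := EffTree) (X := T) (Y := x.out) i)⟩

/-- The number of edges of the trees in an isomorphism class. -/
def edgeCount (x : Pi0 EffTree) : ℕ := Nat.card x.out.E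

lemma edgeCount_cls (T : EffTree) : edgeCount (cls T) = Nat.card T.E := by
  obtain ⟨i⟩ := cls_eq_iff.1 (rfl : cls T = cls T)
  exact (Nat.card_congr i.onE).symm

lemma EffTree.card_edges_le {T : EffTree} (c : T.Cut) :
    Nat.card T.E ≤ Nat.card c.below.E + ∑ᶠ e : c.below.leaves, Nat.card (T.ideal e.1.1).E := by
  classical
  have : Fintype c.below.leaves := Fintype.ofFinite _
  have hsurj : Function.Surjective
      (Sum.elim (fun e : c.below.E => e.1)
        (fun y : Σ e : c.below.leaves, (T.ideal e.1.1).E => y.2.1) : _ → T.E) := by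
    intro x
    induction T.reaches x using Relation.ReflTransGen.head_induction_on with
    | refl => exact ⟨.inl ⟨T.root, c.root_mem⟩, rfl⟩
    | @head x z h _ ih =>
      obtain ⟨m, rfl, rfl⟩ := h
      obtain ⟨⟨y, hy⟩ | ⟨e, ⟨y, hy⟩⟩, hyz⟩ := ih
      · change y = _ at hyz
        subst hyz
        by_cases hm : T.p m ∈ c.nodes
        · exact ⟨.inl ⟨T.s m, (c.in_mem_iff m).2 hm⟩, rfl⟩
        · refine ⟨.inr ⟨⟨⟨_, hy⟩, ?_⟩, ⟨T.s m, .single ⟨m, rfl, rfl⟩⟩⟩, rfl⟩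
          rintro ⟨⟨n, hn⟩, hn'⟩
          have : T.t n = T.t (T.p m) := Subtype.ext_iff.1 hn'
          exact hm (T.t_inj this ▸ hn)
      · change y = _ at hyz
        subst hyz
        exact ⟨.inr ⟨e, ⟨T.s m, .head ⟨m, rfl, rfl⟩ hy⟩⟩, rfl⟩
  have := Nat.card_le_card_of_surjective _ hsurj
  rwa [Nat.card_sum, Nat.card_sigma, ← finsum_eq_sum_of_fintype] at this

/-- Numerical data describing a tree with at most `K` edges. -/
abbrev TreeCode (K : ℕ) := Σ a m n : Fin (K + 1),
  (Fin m → Fin a) × (Fin m → Fin n) × (Fin n → Fin a)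

/-- `T` is described by the given data. -/
def EffTree.IsCoded (T : EffTree) {K : ℕ} (c : TreeCode K) : Prop :=
  ∃ (eE : T.E ≃ Fin c.1) (eM : T.M ≃ Fin c.2.1) (eN : T.N ≃ Fin c.2.2.1),
    (∀ m, eE (T.s m) = c.2.2.2.1 (eM m)) ∧ (∀ m, eN (T.p m) = c.2.2.2.2.1 (eM m)) ∧
      ∀ n, eE (T.t n) = c.2.2.2.2.2 (eN n)

lemma EffTree.exists_isCoded (T : EffTree) {K : ℕ} (h : Nat.card T.E ≤ K) :
    ∃ c : TreeCode K, T.IsCoded c := by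
  have hM := (Nat.card_le_card_of_injective _ T.s_inj).trans h
  have hN := (Nat.card_le_card_of_injective _ T.t_inj).trans h
  let eE := Finite.equivFin T.E
  let eM := Finite.equivFin T.M
  let eN := Finite.equivFin T.N
  exact ⟨⟨⟨_, Nat.lt_succ_of_le h⟩, ⟨_, Nat.lt_succ_of_le hM⟩, ⟨_, Nat.lt_succ_of_le hN⟩,
    fun i => eE (T.s (eM.symm i)), fun i => eN (T.p (eM.symm i)),
    fun i => eE (T.t (eN.symm i))⟩, eE, eM, eN, by simp, by simp, by simp⟩

lemma EffTree.IsCoded.iso {T U : EffTree} {K : ℕ} {c : TreeCode K} (hT : T.IsCoded c)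
    (hU : U.IsCoded c) : Nonempty (EffTree.Iso T U) := by
  obtain ⟨eE, eM, eN, h1, h2, h3⟩ := hT
  obtain ⟨fE, fM, fN, k1, k2, k3⟩ := hU
  exact ⟨⟨eE.trans fE.symm, eM.trans fM.symm, eN.trans fN.symm,
    fun m => by simp [Equiv.symm_apply_eq, h1, k1],
    fun m => by simp [Equiv.symm_apply_eq, h2, k2],
    fun m => by simp [Equiv.symm_apply_eq, h3, k3]⟩⟩

lemma finite_edgeCount_le (K : ℕ) : {x : Pi0 EffTree | edgeCount x ≤ K}.Finite := by
  choose f hf using fun x : {x : Pi0 EffTree // edgeCount x ≤ K} => x.1.out.exists_isCoded x.2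
  refine Set.finite_coe_iff.1 (Finite.of_injective f ?_)
  intro x y hxy
  apply Subtype.ext
  have h := (hf x).iso (hxy ▸ hf y)
  rw [← cls_eq_iff] at h
  rw [← h]
  exact (Quotient.out_eq x.1).symm

lemma exists_of_coeff_treeComulGen {x : Pi0 EffTree} {d : Pi0 EffTree ⊕ Pi0 EffTree →₀ ℕ}
    (h : MvPowerSeries.coeff d (treeComulGen x) ≠ 0) :
    ∃ c : x.out.Cut, d = (∑ᶠ e : c.below.leaves,
      Finsupp.single (Sum.inl (cls (x.out.ideal e.1.1))) 1) +
        Finsupp.single (Sum.inr (cls c.below)) 1 := by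
  classical
  have : Fintype x.out.Cut := Fintype.ofFinite _
  rw [treeComulGen, finsum_eq_sum_of_fintype, map_sum] at h
  obtain ⟨c, -, hc⟩ := Finset.exists_ne_zero_of_sum_ne_zero h
  refine ⟨c, ?_⟩
  have : Fintype c.below.leaves := Fintype.ofFinite _
  rw [finprod_eq_prod_of_fintype] at hc
  rw [finsum_eq_sum_of_fintype]
  have hprod : ∀ s : Finset c.below.leaves, (∏ e ∈ s,
      (MvPowerSeries.X (Sum.inl (cls (x.out.ideal e.1.1))) : TensorSq (Pi0 EffTree))) =
      MvPowerSeries.monomial (∑ e ∈ s,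
        Finsupp.single (Sum.inl (cls (x.out.ideal e.1.1))) 1) 1 := by
    intro s
    induction s using Finset.induction_on with
    | empty => simp
    | insert a s ha ih =>
      rw [Finset.prod_insert ha, Finset.sum_insert ha, ih, MvPowerSeries.X,
        MvPowerSeries.monomial_mul_monomial, one_mul]
  rw [hprod, MvPowerSeries.X, MvPowerSeries.monomial_mul_monomial, MvPowerSeries.coeff_monomial]
    at hc
  by_contra hd
  simp [hd] at hc

lemma hasSubst_treeComulGen : MvPowerSeries.HasSubst treeComulGen where
  const_coeff x := by
    have : MvPowerSeries.constantCoeff (treeComulGen x) = 0 := by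
      by_contra h
      obtain ⟨c, hc⟩ := exists_of_coeff_treeComulGen (d := 0) h
      have := congrArg (fun d => d (Sum.inr (cls c.below))) hc
      simp at this
    rw [this]
    exact IsNilpotent.zero
  coeff_zero d := by
    refine (finite_edgeCount_le (Finsupp.weight (Sum.elim edgeCount edgeCount) d)).subset ?_
    intro x hx
    obtain ⟨c, rfl⟩ := exists_of_coeff_treeComulGen hx
    have : Fintype c.below.leaves := Fintype.ofFinite _
    have h := EffTree.card_edges_le c
    rw [finsum_eq_sum_of_fintype] at h ⊢
    change Nat.card x.out.E ≤ _
    simp only [map_add, map_sum, Finsupp.weight_single, Sum.elim_inl, Sum.elim_inr, one_smul,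
      edgeCount_cls]
    omega

/-- The comultiplication of the completed bialgebra of effective trees: the continuous algebra
homomorphism with the given values on the generators. -/
def treeComul : TreeAlg →ₐ[ℚ] TensorSq (Pi0 EffTree) :=
  MvPowerSeries.substAlgHom hasSubst_treeComulGen

/-- The counit on generators: `1` on the trivial tree (no nodes), `0` on all other trees. -/
def treeCounitGen (x : Pi0 EffTree) : ℚ :=
  open Classical in if IsEmpty x.out.N then 1 else 0

/-- The Green function `G = ∑_T δ_T / |Aut T|`. -/
def totalG : TreeAlg := linSeries fun x => 1 / (Nat.card (Aut x.out) : ℚ)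

/-- `g_n`: the part of the Green function given by the trees with `n` leaves. -/
def smallG (n : ℕ+) : TreeAlg := open Classical in
  linSeries fun x => if cls (EffTree.leafMap.obj x.out) = cls (stdSet n) then
    1 / (Nat.card (Aut x.out) : ℚ) else 0

/-- `G_n = ∑ δ_T / |Aut_n(T)|`, the sum being over the isomorphism classes of objects of the
homotopy fibre over `n` of the leaf map. -/
def bigG (n : ℕ+) : TreeAlg := open Classical in
  linSeries fun x => ∑ᶠ y : Pi0 (HFibre EffTree.leafMap (stdSet n)),
    if cls y.out.left = x then 1 / (Nat.card (Aut y.out) : ℚ) else 0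

/-! ### The map `Φ` -/

/-- The homotopy pullback along the leaf map of `q : X ⥤ FinSet`, as a functor to trees. -/
abbrev pullLeaf {X : Type*} [Category X] (q : X ⥤ FinSet) :
    CategoricalPullback EffTree.leafMap q ⥤ EffTree :=
  CategoricalPullback.π₁ EffTree.leafMap q

/-- The image of `A_n`: the relative cardinality of the pullback along the leaf map of the
functor `1 ⥤ FinSet` picking the set with `n` elements. -/
def phiGen (n : ℕ+) : TreeAlg :=
  linSeries (relCard (pullLeaf (Functor.fromPUnit.{0} (stdSet n))))

lemma exists_of_coeff_phiGen {n : ℕ+} {d : Pi0 EffTree →₀ ℕ}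
    (h : MvPowerSeries.coeff d (phiGen n) ≠ 0) : ∃ x : Pi0 EffTree, d = Finsupp.single x 1 ∧
      Nat.card x.out.leaves = n := by
  obtain ⟨x, hd, hx⟩ := exists_of_coeff_linSeries h
  refine ⟨x, hd, ?_⟩
  by_contra hne
  apply hx
  have : IsEmpty (Pi0 (HFibre (pullLeaf (Functor.fromPUnit.{0} (stdSet n))) x.out)) := by
    constructor
    intro y
    obtain ⟨y, rfl⟩ := Quotient.exists_rep y
    apply hne
    have e1 : x.out.leaves ≃ y.left.fst.leaves :=
      (EffTree.leafMap.map (Groupoid.inv (y.hom : y.left.fst ⟶ x.out)) :)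
    have e2 : y.left.fst.leaves ≃ Fin n := y.left.iso.hom
    rw [Nat.card_congr (e1.trans e2), Nat.card_fin]
  rw [relCard, groupoidCard, finsum_of_isEmpty, zero_div]

lemma hasSubst_phiGen : MvPowerSeries.HasSubst phiGen where
  const_coeff n := by
    have : MvPowerSeries.constantCoeff (phiGen n) = 0 := by
      by_contra h
      obtain ⟨x, hx, -⟩ := exists_of_coeff_phiGen (n := n) (d := 0) h
      simpa using congrArg (fun d => d x) hx
    rw [this]
    exact IsNilpotent.zero
  coeff_zero d := by
    apply Set.Subsingleton.finite
    intro m hm n hn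
    obtain ⟨x, hx, hx'⟩ := exists_of_coeff_phiGen hm
    obtain ⟨y, hy, hy'⟩ := exists_of_coeff_phiGen hn
    have : x = y := by
      have h := hx.symm.trans hy
      rwa [Finsupp.single_left_inj one_ne_zero] at h
    subst this
    exact PNat.coe_injective (hx'.symm.trans hy')

/-- The homomorphism `Φ`: the extension to a continuous algebra homomorphism of the pullback along
the leaf map. -/
def Phi : FaaDiBruno →ₐ[ℚ] TreeAlg := MvPowerSeries.substAlgHom hasSubst_phiGen

/-- The homomorphism `Φ ⊗ Φ`. -/
def PhiPhi : TensorSq ℕ+ →ₐ[ℚ] TensorSq (Pi0 EffTree) := tensorHom hasSubst_phiGen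

end FdB

end

noncomputable section

namespace FdB

/-! ### Groupoid cardinality -/

section Cardinality

variable {C D : Type*} [Category C] [Category D]

/-! Pullback along the leaf map. The homotopy fibre over a tree `T` of the pullback of `q` is
equivalent to the homotopy fibre of `q` over the leaf set of `T` (`pullbackFibre`). Relative
cardinality therefore changes only in its denominator: for a tree with `n` leaves, `n!` is replaced
by `|Aut T|` (`relCard_pullLeaf`). Each tree has one leaf number, so `Φ` of a series of degree one
can be read off tree by tree (`Phi_linSeries`), and the formulas for `q`, `a_n` and `A` are
instances. For `G_n`, the objects of the fibre lying over `T` form orbits of `Aut T` on the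
bijections from the leaves to `n`, with the groups `Aut_n` as stabilisers; orbit-stabiliser counting
gives the same coefficients (`finsum_fibre_over`).

Comultiplication. All the maps are substitutions, so it is enough to compare them on `A_n`,
coefficient by coefficient. Only monomials `∏ δ_{φ l} ⊗ δ_y` occur, where `φ` labels the leaves `l`
of `y` by classes of trees. On both sides the coefficient is `n! / |Aut y|` times the sum of `∏ 1 /
|Aut (φ l)|` over the labellings with this monomial and `n` leaves in total. On the Faà di Bruno
side this is the expansion of a power of `∑ (g_k ⊗ 1) z ^ k`, whose exponent is the number of leaves
of `y`.

On the tree side it rests on a bijection (`card_decomposition`): an isomorphism from the grafting of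
trees `P l` onto the leaves of `S` to a tree `T` is the same as a cut of `T`, an isomorphism from
`S` to the tree below it, and isomorphisms from the `P l` to the trees above it. Counting gives
automorphism factors, and in the sum over `T` each labelling picks out a single class, that of the
grafted tree, whose `|Aut T|` cancels the denominator in `Φ(A_n)`.

Counit. The two counits see only the powers of one variable: `A_1`, respectively the trivial tree.
The trivial tree occurs among the `Φ(A_n)` only in `Φ(A_1)`, with coefficient `1`, so the
coefficients of these powers agree in `f` and `Φ(f)` (`coeff_single_Phi`). -/

lemma cls_eq_cls {x y : C} : cls x = cls y ↔ Nonempty (x ≅ y) :=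
  Quotient.eq (r := isIsomorphicSetoid C)

lemma cls_out (x : Pi0 C) : cls x.out = x := Quotient.out_eq x

lemma nonempty_iso_out (x : C) : Nonempty ((cls x).out ≅ x) :=
  cls_eq_cls.1 (cls_out _)

lemma card_aut_congr {x y : C} (e : x ≅ y) : Nat.card (Aut x) = Nat.card (Aut y) :=
  Nat.card_congr (e.conjAut).toEquiv

lemma card_aut_out (x : C) : Nat.card (Aut (cls x).out) = Nat.card (Aut x) :=
  let ⟨e⟩ := nonempty_iso_out x
  card_aut_congr e

lemma card_aut_map (F : C ⥤ D) [F.Full] [F.Faithful] (x : C) :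
    Nat.card (Aut x) = Nat.card (Aut (F.obj x)) :=
  Nat.card_congr ((Functor.FullyFaithful.ofFullyFaithful F).autMulEquivOfFullyFaithful x).toEquiv

/-- The map induced by a functor on isomorphism classes. -/
def pi0Map (F : C ⥤ D) : Pi0 C → Pi0 D :=
  Quotient.map (sa := isIsomorphicSetoid C) (sb := isIsomorphicSetoid D) F.obj
    fun _ _ ⟨e⟩ => ⟨F.mapIso e⟩

lemma pi0Map_cls (F : C ⥤ D) (x : C) : pi0Map F (cls x) = cls (F.obj x) := rfl

lemma pi0Map_bijective (F : C ⥤ D) [F.Full] [F.Faithful] [F.EssSurj] :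
    Function.Bijective (pi0Map F) := by
  constructor
  · intro x y h
    rw [← cls_out x, ← cls_out y] at h ⊢
    rw [pi0Map_cls, pi0Map_cls, cls_eq_cls] at h
    obtain ⟨e⟩ := h
    exact cls_eq_cls.2 ⟨F.preimageIso e⟩
  · intro y
    refine ⟨cls (F.objPreimage y.out), ?_⟩
    rw [pi0Map_cls]
    exact (cls_eq_cls.2 ⟨F.objObjPreimageIso _⟩).trans (cls_out y)

lemma groupoidCard_congr (F : C ⥤ D) [F.Full] [F.Faithful] [F.EssSurj] :
    groupoidCard C = groupoidCard D := by
  refine finsum_eq_of_bijective _ (pi0Map_bijective F) fun x => ?_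
  have : pi0Map F x = cls (F.obj x.out) := by rw [← pi0Map_cls, cls_out]
  rw [this, card_aut_out, card_aut_map F]

lemma isFiniteGroupoid_of_equivalence (F : C ⥤ D) [F.Full] [F.Faithful] [F.EssSurj]
    (h : IsFiniteGroupoid D) : IsFiniteGroupoid C := by
  obtain ⟨h1, h2⟩ := h
  refine ⟨Finite.of_injective _ (pi0Map_bijective F).1, fun x => ?_⟩
  have := h2 (F.obj x)
  exact Finite.of_equiv _
    ((Functor.FullyFaithful.ofFullyFaithful F).autMulEquivOfFullyFaithful x).symm.toEquiv

end Cardinality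

lemma card_iso_of_cls_eq {C : Type*} [Category C] {x y : C} (h : cls x = cls y) :
    Nat.card (x ≅ y) = Nat.card (Aut y) :=
  let ⟨e⟩ := cls_eq_cls.1 h
  Nat.card_congr ((Iso.isoCongr e (Iso.refl y)))

lemma card_iso_of_cls_ne {C : Type*} [Category C] {x y : C} (h : cls x ≠ cls y) :
    Nat.card (x ≅ y) = 0 :=
  have : IsEmpty (x ≅ y) := ⟨fun e => h (cls_eq_cls.2 ⟨e⟩)⟩
  Nat.card_of_isEmpty

section Fibres

variable {X B : Type*} [Category X] [Groupoid B]

lemma groupoidCard_hFibre_congr (p : X ⥤ B) {b b' : B} (e : b ≅ b') :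
    groupoidCard (HFibre p b) = groupoidCard (HFibre p b') :=
  groupoidCard_congr (CostructuredArrow.mapIso (S := p) e).functor

lemma relCard_cls (p : X ⥤ B) (b : B) :
    relCard p (cls b) = groupoidCard (HFibre p b) / (Nat.card (Aut b) : ℚ) := by
  obtain ⟨e⟩ := nonempty_iso_out b
  rw [relCard, groupoidCard_hFibre_congr p e, card_aut_out]

end Fibres

/-! ### Homotopy fibres of a homotopy pullback -/

section Pullback

variable {A X B : Type*} [Groupoid A] [Groupoid X] [Groupoid B] (p : A ⥤ B) (q : X ⥤ B)

/-- The first equation makes `(k, g)` a morphism of the pullback, the second makes `g` a morphism of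
the homotopy fibre of `q`. This one equivalence serves both to define `pullbackFibre` and to prove
it full. -/
lemma pullback_comm_iff {a a₁ a₂ : A} {x₁ x₂ : X} {φ₁ : a₁ ⟶ a} {φ₂ : a₂ ⟶ a} {k : a₁ ⟶ a₂}
    (hk : k ≫ φ₂ = φ₁) (i₁ : p.obj a₁ ≅ q.obj x₁) (i₂ : p.obj a₂ ≅ q.obj x₂) (g : x₁ ⟶ x₂) :
    p.map k ≫ i₂.hom = i₁.hom ≫ q.map g ↔
      q.map g ≫ i₂.inv ≫ p.map φ₂ = i₁.inv ≫ p.map φ₁ := by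
  rw [← hk, p.map_comp, ← Category.assoc, ← Category.assoc, cancel_mono, Iso.comp_inv_eq,
    Category.assoc, Iso.eq_inv_comp, eq_comm]

/-- The comparison from a homotopy fibre of the pullback of `q` along `p` to the homotopy fibre
of `q`. -/
def pullbackFibre (a : A) :
    HFibre (CategoricalPullback.π₁ p q) a ⥤ HFibre q (p.obj a) where
  obj y := CostructuredArrow.mk (Y := y.left.snd) (y.left.iso.inv ≫ p.map y.hom)
  map {y z} f := CostructuredArrow.homMk f.left.snd
    ((pullback_comm_iff p q (CostructuredArrow.w f) _ _ _).1 f.left.w)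

instance (a : A) : (pullbackFibre p q a).Faithful where
  map_injective {y z} f g h := by
    have hf : f.left.fst ≫ z.hom = y.hom := CostructuredArrow.w f
    have hg : g.left.fst ≫ z.hom = y.hom := CostructuredArrow.w g
    apply CostructuredArrow.hom_ext
    apply CategoricalPullback.hom_ext
    · exact (cancel_mono (show z.left.fst ⟶ a from z.hom)).1 (hf.trans hg.symm)
    · exact congrArg CommaMorphism.left h

instance (a : A) : (pullbackFibre p q a).Full where
  map_surjective {y z} f := by
    -- In a groupoid the component in `A` is forced by the triangle over `a`.
    obtain ⟨k, hk⟩ : ∃ k : y.left.fst ⟶ z.left.fst, k ≫ z.hom = y.hom := by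
      have (a₁ a₂ : A) (f : a₁ ⟶ a) (g : a₂ ⟶ a) : ∃ k, k ≫ g = f :=
        ⟨f ≫ Groupoid.inv g, by simp⟩
      exact this _ _ _ _
    have hw := (pullback_comm_iff p q hk y.left.iso z.left.iso f.left).2 (CostructuredArrow.w f)
    exact ⟨CostructuredArrow.homMk ⟨k, f.left, hw⟩ hk, CostructuredArrow.hom_ext _ _ rfl⟩

instance (a : A) : (pullbackFibre p q a).EssSurj where
  mem_essImage z := by
    -- The preimage has `a` itself as first component, lying over `a` by the identity.
    let w : CategoricalPullback p q :=
      ⟨a, z.left, (Groupoid.isoEquivHom _ _).symm (Groupoid.inv z.hom)⟩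
    refine ⟨CostructuredArrow.mk (S := CategoricalPullback.π₁ p q) (Y := w) (𝟙 a), ⟨?_⟩⟩
    refine CostructuredArrow.isoMk (Iso.refl _) ?_
    have : q.map (𝟙 z.left) ≫ z.hom = w.iso.inv ≫ p.map (𝟙 a) := by
      simp [w, Groupoid.isoEquivHom]
    exact this

lemma relCard_pullback (a : Pi0 A) :
    relCard (CategoricalPullback.π₁ p q) a =
      groupoidCard (HFibre q (p.obj a.out)) / (Nat.card (Aut a.out) : ℚ) := by
  rw [relCard, groupoidCard_congr (pullbackFibre p q a.out)]

lemma finiteFibres_pullback (h : FiniteFibres q) : FiniteFibres (CategoricalPullback.π₁ p q) :=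
  fun a => isFiniteGroupoid_of_equivalence (pullbackFibre p q a) (h _)

end Pullback
-- Fibres of a point, and orbit counting in a homotopy fibre
section Point

variable {A B : Type*} [Groupoid A] [Groupoid B]

lemma cls_point_injective (b b' : B) : Function.Injective fun f : b ⟶ b' =>
    cls (CostructuredArrow.mk (S := Functor.fromPUnit.{0} b) (Y := ⟨PUnit.unit⟩) f) := by
  intro f g h
  obtain ⟨e⟩ := cls_eq_cls.1 h
  have : (Functor.fromPUnit.{0} b).map e.hom.left ≫ g = f := CostructuredArrow.w e.hom
  exact (this.symm.trans (Category.id_comp g))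

/-- The one-point category has only identities, so the fibre is discrete: the set of arrows `b ⟶
b'`. -/
lemma groupoidCard_point (b b' : B) [Finite (b ⟶ b')] :
    groupoidCard (HFibre (Functor.fromPUnit.{0} b) b') = (Nat.card (b ⟶ b') : ℚ) := by
  have hb : Function.Bijective fun f : b ⟶ b' =>
      cls (CostructuredArrow.mk (S := Functor.fromPUnit.{0} b) (Y := ⟨PUnit.unit⟩) f) := by
    refine ⟨cls_point_injective b b', fun y => ?_⟩
    rw [← cls_out y]
    exact ⟨y.out.hom, rfl⟩
  rw [groupoidCard, ← finsum_eq_of_bijective (f := fun _ => 1) _ hb fun f => ?_]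
  · have : Fintype (b ⟶ b') := Fintype.ofFinite _
    rw [finsum_eq_sum_of_fintype, Finset.sum_const, nsmul_one, Finset.card_univ,
      Nat.card_eq_fintype_card]
  · have : Subsingleton (Aut (CostructuredArrow.mk (S := Functor.fromPUnit.{0} b)
        (Y := ⟨PUnit.unit⟩) f)) :=
      ⟨fun e e' => Iso.ext (CostructuredArrow.hom_ext _ _ (Subsingleton.elim _ _))⟩
    rw [card_aut_out, Nat.card_unique]
    simp

/-- The isomorphisms between two objects `p a ⟶ b` of a homotopy fibre, the first one varying. -/
def fibreIsoEquiv (p : A ⥤ B) {a : A} {b : B} (z₀ : p.obj a ⟶ b) :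
    (Σ z : p.obj a ⟶ b, CostructuredArrow.mk z ≅ CostructuredArrow.mk z₀) ≃ Aut a :=
  Equiv.ofBijective (fun e => (CostructuredArrow.proj p b).mapIso e.2) <| by
    constructor
    · rintro ⟨z, e⟩ ⟨z', e'⟩ h
      have h' : e.hom.left = e'.hom.left := congrArg Iso.hom h
      have hz : p.map e.hom.left ≫ z₀ = z := CostructuredArrow.w e.hom
      have hz' : p.map e'.hom.left ≫ z₀ = z' := CostructuredArrow.w e'.hom
      obtain rfl : z = z' := by rw [← hz, ← hz', h']
      exact Sigma.ext rfl (heq_of_eq (Iso.ext (CostructuredArrow.hom_ext _ _ h')))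
    · intro g
      exact ⟨⟨p.map g.hom ≫ z₀, CostructuredArrow.isoMk g rfl⟩, Iso.ext rfl⟩

/-- Orbit-stabiliser for `Aut a` acting on the arrows `p a ⟶ b` by precomposition: the classes of
the fibre lying over `a` are the orbits, and their automorphism groups are the stabilisers. -/
lemma finsum_fibre_over (p : A ⥤ B) (a : A) (b : B) [Finite (Aut a)] [Finite (p.obj a ⟶ b)] :
    (∑ᶠ y : Pi0 (HFibre p b), open Classical in
      if cls y.out.left = cls a then 1 / (Nat.card (Aut y.out) : ℚ) else 0) =
      Nat.card (p.obj a ⟶ b) / (Nat.card (Aut a) : ℚ) := by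
  classical
  have : Fintype (p.obj a ⟶ b) := Fintype.ofFinite _
  let κ : (p.obj a ⟶ b) → Pi0 (HFibre p b) := fun z => cls (CostructuredArrow.mk z)
  have hκ (y : Pi0 (HFibre p b)) : cls y.out.left = cls a ↔ ∃ z, κ z = y := by
    constructor
    · intro h
      obtain ⟨e⟩ := cls_eq_cls.1 h
      refine ⟨p.map e.inv ≫ y.out.hom, ?_⟩
      have h' : κ (p.map e.inv ≫ y.out.hom) = cls y.out :=
        cls_eq_cls.2 ⟨CostructuredArrow.isoMk e.symm (by simp)⟩
      rw [h', cls_out]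
    · rintro ⟨z, rfl⟩
      obtain ⟨e⟩ := nonempty_iso_out (CostructuredArrow.mk z)
      exact cls_eq_cls.2 ⟨(CostructuredArrow.proj p b).mapIso e⟩
  have hpos : (Nat.card (Aut a) : ℚ) ≠ 0 := Nat.cast_ne_zero.2 Nat.card_pos.ne'
  -- The size of the orbit of `z₀` times the order of its stabiliser, obtained by sorting
  -- `fibreIsoEquiv` by the source `z`.
  have hfib (z₀ : p.obj a ⟶ b) : (Nat.card (Aut a) : ℚ) =
      (Finset.univ.filter fun z => κ z = κ z₀).card *
        (Nat.card (Aut (κ z₀).out) : ℚ) := by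
    rw [← Nat.card_congr (fibreIsoEquiv p z₀)]
    have (z : p.obj a ⟶ b) : Finite (CostructuredArrow.mk z ≅ CostructuredArrow.mk z₀) :=
      Finite.of_injective (fun e => fibreIsoEquiv p z₀ ⟨z, e⟩) fun e e' h => by
        simpa using (fibreIsoEquiv p z₀).injective h
    rw [Nat.card_sigma, Finset.sum_congr rfl (g := fun z =>
      if κ z = κ z₀ then Nat.card (Aut (κ z₀).out) else 0)]
    · rw [← Finset.sum_filter, Finset.sum_const, smul_eq_mul, Nat.cast_mul]
    · intro z _
      split_ifs with h
      · rw [card_iso_of_cls_eq h, card_aut_out]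
      · rw [card_iso_of_cls_ne h]
  rw [finsum_eq_sum_of_support_subset (s := Finset.univ.image κ)]
  · rw [eq_div_iff hpos, Nat.card_eq_fintype_card (α := p.obj a ⟶ b), ← Finset.card_univ,
      Finset.card_eq_sum_card_image κ Finset.univ, Nat.cast_sum, Finset.sum_mul]
    refine Finset.sum_congr rfl fun y hy => ?_
    obtain ⟨z₀, -, rfl⟩ := Finset.mem_image.1 hy
    rw [if_pos ((hκ _).2 ⟨z₀, rfl⟩), hfib z₀]
    have : (Nat.card (Aut (κ z₀).out) : ℚ) ≠ 0 := fun h => hpos (by rw [hfib z₀, h, mul_zero])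
    field_simp
  · intro y hy
    by_cases h : cls y.out.left = cls a
    · simpa using (hκ y).1 h
    · simp [h] at hy

end Point

/-! ### The homomorphism on series of degree one -/

section LinSeries

variable {σ τ : Type*}

lemma linSeries_ext {f : MvPowerSeries σ ℚ} {c : σ → ℚ}
    (h1 : ∀ i, MvPowerSeries.coeff (Finsupp.single i 1) f = c i)
    (h2 : ∀ d, (∀ i, d ≠ Finsupp.single i 1) → MvPowerSeries.coeff d f = 0) :
    f = linSeries c := by
  ext d
  by_cases hd : ∃ i, d = Finsupp.single i 1
  · obtain ⟨i, rfl⟩ := hd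
    rw [h1, coeff_linSeries_single]
  · push Not at hd
    rw [h2 d hd]
    by_contra h
    obtain ⟨i, hi, -⟩ := exists_of_coeff_linSeries (Ne.symm h)
    exact hd i hi

lemma coeff_subst_linSeries {a : σ → MvPowerSeries τ ℚ} (ha : MvPowerSeries.HasSubst a)
    (c : σ → ℚ) (d : τ →₀ ℕ) :
    MvPowerSeries.coeff d (MvPowerSeries.subst a (linSeries c)) =
      ∑ᶠ i, c i * MvPowerSeries.coeff d (a i) := by
  rw [MvPowerSeries.coeff_subst ha]
  have hinj : Function.Injective fun i : σ => Finsupp.single i 1 :=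
    Finsupp.single_left_injective one_ne_zero
  rw [← finsum_mem_univ,
    finsum_mem_inter_support_eq' _ _ (Set.range fun i : σ => Finsupp.single i 1),
    finsum_mem_range hinj]
  · simp [coeff_linSeries_single]
  · intro e he
    refine iff_of_true trivial ?_
    obtain ⟨i, hi, -⟩ := exists_of_coeff_linSeries (left_ne_zero_of_mul he)
    exact ⟨i, hi.symm⟩

end LinSeries

/-- The number of leaves of the trees in an isomorphism class. -/
def leafCount (x : Pi0 EffTree) : ℕ+ := ⟨Nat.card x.out.leaves,
  have := x.out.leaves_nonempty
  Nat.card_pos⟩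

lemma FinSet.card_hom (X Y : FinSet) : Nat.card (X ⟶ Y) =
    open Classical in if Nat.card X.carrier = Nat.card Y.carrier then
      (Nat.card X.carrier).factorial else 0 := by
  classical
  change Nat.card (X.carrier ≃ Y.carrier) = _
  have : Fintype X.carrier := Fintype.ofFinite _
  have : Fintype Y.carrier := Fintype.ofFinite _
  split_ifs with h
  · obtain ⟨e⟩ := (Finite.card_eq (α := X.carrier) (β := Y.carrier)).1 h
    rw [Nat.card_eq_fintype_card, Fintype.card_equiv e, Nat.card_eq_fintype_card]
  · have : IsEmpty (X.carrier ≃ Y.carrier) := ⟨fun e => h (Nat.card_congr e)⟩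
    exact Nat.card_of_isEmpty

lemma FinSet.iso_of_card_eq {X Y : FinSet} (h : Nat.card X.carrier = Nat.card Y.carrier) :
    Nonempty (X ≅ Y) :=
  let ⟨e⟩ := (Finite.card_eq (α := X.carrier) (β := Y.carrier)).1 h
  ⟨asIso (show X ⟶ Y from e)⟩

instance (X Y : FinSet) : Finite (X ⟶ Y) := inferInstanceAs (Finite (X.carrier ≃ Y.carrier))

lemma FinSet.card_aut (X : FinSet) : Nat.card (Aut X) = (Nat.card X.carrier).factorial := by
  have h := FinSet.card_hom X X
  rw [if_pos rfl] at h
  rw [← h]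
  exact Nat.card_congr (Groupoid.isoEquivHom X X)

lemma FinSet.card_stdSet (n : ℕ+) : Nat.card (stdSet n).carrier = n := Nat.card_fin _

lemma FinSet.iso_stdSet_iff (X : FinSet) (n : ℕ+) :
    cls X = cls (stdSet n) ↔ Nat.card X.carrier = n := by
  rw [cls_eq_cls, ← card_stdSet n]
  exact ⟨fun ⟨e⟩ => Nat.card_congr (Groupoid.isoEquivHom _ _ e), iso_of_card_eq⟩

lemma card_leafSet_out (x : Pi0 EffTree) :
    Nat.card (EffTree.leafMap.obj x.out).carrier = leafCount x := rfl

lemma card_leafMap_hom (x : Pi0 EffTree) (n : ℕ+) :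
    Nat.card (EffTree.leafMap.obj x.out ⟶ stdSet n) =
      if leafCount x = n then (n : ℕ).factorial else 0 := by
  classical
  rw [FinSet.card_hom, FinSet.card_stdSet, card_leafSet_out]
  simp only [PNat.coe_inj]
  split_ifs with h
  · rw [h]
  · rfl

instance (T U : EffTree) : Finite (EffTree.Iso T U) :=
  Finite.of_injective (fun f : EffTree.Iso T U => (f.onE, f.onM, f.onN)) fun f g h => by
    cases f; cases g; simp_all

instance (T : EffTree) : Finite (Aut T) :=
  Finite.of_injective (fun e : Aut T => (show EffTree.Iso T T from e.hom)) fun _ _ h => Iso.ext h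

/-- The order of the automorphism group of a tree. -/
def autCard (x : Pi0 EffTree) : ℚ := Nat.card (Aut x.out)

lemma autCard_ne_zero (x : Pi0 EffTree) : autCard x ≠ 0 := Nat.cast_ne_zero.2 Nat.card_pos.ne'

/-- The fibres have the same cardinality. The factorial undoes the division by the automorphisms of
the leaf set that is built into `relCard q`. -/
lemma relCard_pullLeaf {X : Type*} [Groupoid X] (q : X ⥤ FinSet) (x : Pi0 EffTree) :
    relCard (pullLeaf q) x = relCard q (cls (stdSet (leafCount x))) *
      ((leafCount x : ℕ).factorial / autCard x) := by
  obtain ⟨e⟩ := (FinSet.iso_stdSet_iff (EffTree.leafMap.obj x.out) (leafCount x)).2 rfl |>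
    cls_eq_cls.1
  have h : ((leafCount x : ℕ).factorial : ℚ) ≠ 0 := Nat.cast_ne_zero.2 (Nat.factorial_ne_zero _)
  rw [relCard_pullback, relCard_cls, groupoidCard_hFibre_congr q e, FinSet.card_aut,
    FinSet.card_stdSet, autCard]
  field_simp

lemma relCard_point (m n : ℕ+) :
    relCard (Functor.fromPUnit.{0} (stdSet n)) (cls (stdSet m)) = if m = n then 1 else 0 := by
  rw [relCard_cls, groupoidCard_point, FinSet.card_hom, FinSet.card_aut, FinSet.card_stdSet,
    FinSet.card_stdSet]
  have h : ((m : ℕ).factorial : ℚ) ≠ 0 := Nat.cast_ne_zero.2 (Nat.factorial_ne_zero _)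
  by_cases hmn : m = n
  · subst hmn
    simp [h]
  · have : (n : ℕ) ≠ m := fun h => hmn (PNat.coe_injective h.symm)
    simp [hmn, this]

lemma phiGen_eq (n : ℕ+) : phiGen n = linSeries fun x =>
    if leafCount x = n then ((leafCount x : ℕ).factorial : ℚ) / autCard x else 0 := by
  rw [phiGen]
  congr 1
  ext x
  rw [relCard_pullLeaf, relCard_point]
  split_ifs <;> simp

/-- A tree occurs in `Φ(A_n)` only when `n` is its number of leaves, so each coefficient of the
infinite sum has a single term. -/
lemma Phi_linSeries (c : ℕ+ → ℚ) : Phi (linSeries c) = linSeries fun x =>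
    c (leafCount x) * ((leafCount x : ℕ).factorial / autCard x) := by
  have key (d : Pi0 EffTree →₀ ℕ) : MvPowerSeries.coeff d (Phi (linSeries c)) =
      ∑ᶠ n, c n * MvPowerSeries.coeff d (phiGen n) := by
    rw [Phi, MvPowerSeries.substAlgHom_apply,
      coeff_subst_linSeries hasSubst_phiGen]
  refine linSeries_ext (fun x => ?_) fun d hd => ?_
  · rw [key, finsum_eq_single _ (leafCount x)]
    · rw [phiGen_eq, coeff_linSeries_single, if_pos rfl]
    · intro n hn
      rw [phiGen_eq, coeff_linSeries_single, if_neg hn.symm, mul_zero]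
  · rw [key, ← finsum_zero (α := ℕ+)]
    refine finsum_congr fun n => ?_
    by_contra h
    obtain ⟨x, hx, -⟩ := exists_of_coeff_phiGen (right_ne_zero_of_mul h)
    exact hd x hx

lemma Phi_relCard {X : Type*} [Groupoid X] (q : X ⥤ FinSet) :
    Phi (linSeries fun n : ℕ+ => relCard q (cls (stdSet n))) =
      linSeries (relCard (pullLeaf q)) := by
  rw [Phi_linSeries]
  exact congrArg _ (funext fun x => (relCard_pullLeaf q x).symm)

lemma Phi_bigA (n : ℕ+) : Phi (bigA n) = phiGen n :=
  MvPowerSeries.substAlgHom_X hasSubst_phiGen n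

lemma bigG_eq (n : ℕ+) : bigG n = phiGen n := by
  rw [bigG, phiGen_eq]
  congr 1
  ext x
  have h := finsum_fibre_over EffTree.leafMap x.out (stdSet n)
  rw [cls_out] at h
  rw [h, card_leafMap_hom, autCard]
  split_ifs with h
  · rw [h]
  · simp

lemma linSeries_smul {σ : Type*} (r : ℚ) (c : σ → ℚ) :
    r • linSeries c = linSeries fun i => r * c i := by
  refine linSeries_ext (fun i => ?_) fun d hd => ?_
  · rw [MvPowerSeries.coeff_smul, coeff_linSeries_single]
  · rw [MvPowerSeries.coeff_smul]
    by_contra h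
    obtain ⟨i, hi, -⟩ := exists_of_coeff_linSeries (right_ne_zero_of_mul h)
    exact hd i hi

lemma smallG_eq (n : ℕ+) : smallG n = linSeries fun x =>
    if leafCount x = n then 1 / autCard x else 0 := by
  rw [smallG]
  congr 1
  ext x
  simp only [FinSet.iso_stdSet_iff, card_leafSet_out, PNat.coe_inj]
  rfl

lemma smul_phiGen (n : ℕ+) : (1 / ((n : ℕ).factorial : ℚ)) • phiGen n = smallG n := by
  rw [phiGen_eq, linSeries_smul, smallG_eq]
  congr 1
  ext x
  have h : ((n : ℕ).factorial : ℚ) ≠ 0 := Nat.cast_ne_zero.2 (Nat.factorial_ne_zero _)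
  split_ifs with hx
  · rw [hx]
    field_simp
  · simp

lemma Phi_smallA (n : ℕ+) : Phi (smallA n) = smallG n := by
  rw [smallA, map_smul, Phi_bigA, smul_phiGen]

lemma Phi_totalA : Phi totalA = totalG := by
  rw [totalA, Phi_linSeries, totalG]
  congr 1
  ext x
  have h : ((leafCount x : ℕ).factorial : ℚ) ≠ 0 := Nat.cast_ne_zero.2 (Nat.factorial_ne_zero _)
  rw [autCard]
  field_simp

/-! ### Grafting of trees -/

namespace EffTree

section Isomorphisms

variable {T U : EffTree}

/-- An edge is the root or is marked by an input. -/
def optionEquivE (T : EffTree) : Option T.M ≃ T.E :=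
  Equiv.ofBijective (fun x => x.elim T.root T.s) <| by
    constructor
    · rintro (_ | m) (_ | m') h
      · rfl
      · exact absurd h.symm (s_ne_root m')
      · exact absurd h (s_ne_root m)
      · exact congrArg some (T.s_inj h)
    · intro e
      by_cases h : e = T.root
      · exact ⟨none, h.symm⟩
      · obtain ⟨m, hm⟩ := exists_s h
        exact ⟨some m, hm⟩

lemma card_E (T : EffTree) : Nat.card T.E = Nat.card T.M + 1 := by
  rw [← Nat.card_congr T.optionEquivE, Finite.card_option]

/-- A morphism of diagrams which is bijective on edges is an isomorphism. -/
def Iso.ofBijective (fE : T.E → U.E) (fM : T.M → U.M) (fN : T.N → U.N)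
    (hE : Function.Bijective fE) (hs : ∀ m, fE (T.s m) = U.s (fM m))
    (hp : ∀ m, fN (T.p m) = U.p (fM m)) (ht : ∀ n, fE (T.t n) = U.t (fN n)) : Iso T U :=
  have hM : Function.Bijective fM := by
    have hinj : Function.Injective fM := fun m m' h =>
      T.s_inj (hE.1 (by rw [hs, hs, h]))
    -- In each tree the edges are the marked inputs and one root, so equally many edges means
    -- equally many inputs.
    refine hinj.bijective_of_nat_card_le ?_
    have := Nat.card_congr (Equiv.ofBijective fE hE)
    rw [card_E, card_E] at this
    omega
  have hN : Function.Bijective fN := by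
    refine ⟨fun n n' h => T.t_inj (hE.1 (by rw [ht, ht, h])), fun n => ?_⟩
    obtain ⟨m, rfl⟩ := U.p_surj n
    obtain ⟨m', rfl⟩ := hM.2 m
    exact ⟨T.p m', hp m'⟩
  { onE := Equiv.ofBijective fE hE
    onM := Equiv.ofBijective fM hM
    onN := Equiv.ofBijective fN hN
    comm_s := hs
    comm_p := hp
    comm_t := ht }

/-- Inputs are determined by their edges since `s` is injective, and nodes by their inputs since
there are no nullary nodes. -/
lemma Iso.ext_onE {f g : Iso T U} (h : ∀ e, f.onE e = g.onE e) : f = g := by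
  have hM (m : T.M) : f.onM m = g.onM m := U.s_inj (by rw [← f.comm_s, ← g.comm_s, h])
  refine Iso.ext (Equiv.ext h) (Equiv.ext hM) (Equiv.ext fun n => ?_)
  obtain ⟨m, rfl⟩ := T.p_surj n
  rw [f.comm_p, g.comm_p, hM]

lemma Iso.onE_root (f : Iso T U) : f.onE T.root = U.root := by
  by_contra h
  obtain ⟨m, hm⟩ := exists_s h
  obtain ⟨m', rfl⟩ := f.onM.surjective m
  rw [← f.comm_s] at hm
  exact s_ne_root m' (f.onE.injective hm)

lemma card_iso (T U : EffTree) : Nat.card (Iso T U) = Nat.card (T ≅ U) :=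
  (Nat.card_congr (Groupoid.isoEquivHom T U)).symm

lemma card_iso_out (x : Pi0 EffTree) (T : EffTree) :
    (Nat.card (Iso x.out T) : ℚ) =
      open Classical in if cls T = x then autCard x else 0 := by
  rw [card_iso]
  split_ifs with h
  · subst h
    obtain ⟨e⟩ := nonempty_iso_out T
    rw [autCard, card_aut_out, card_iso_of_cls_eq (cls_out _)]
  · rw [card_iso_of_cls_ne (by rwa [cls_out, ne_comm]), Nat.cast_zero]

end Isomorphisms

/-! ### Edges inside a cut and above its leaves -/

section Cuts

variable {T : EffTree}

lemma Cut.ext_edges {c d : T.Cut} (h : c.edges = d.edges) : c = d := by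
  have hN : c.nodes = d.nodes := by
    ext n
    obtain ⟨m, rfl⟩ := T.p_surj n
    rw [← c.in_mem_iff, ← d.in_mem_iff, h]
  cases c
  cases d
  simp_all

/-- The walk to the root is deterministic, so the edges it meets form a chain. -/
lemma Above.total {x y z : T.E} (h : T.Above x y) (h' : T.Above x z) :
    T.Above y z ∨ T.Above z y :=
  Relation.ReflTransGen.total_of_right_unique (fun _ _ _ => step_functional) h h'

/-- No edge of the subtree of a cut is strictly above a leaf of the subtree. -/
lemma Cut.eq_of_above_leaf (c : T.Cut) (l : c.below.leaves) {x : T.E} (hx : x ∈ c.edges)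
    (h : T.Above x l.1.1) : x = l.1.1 := by
  induction h using Relation.ReflTransGen.head_induction_on with
  | refl => rfl
  | head hstep _ ih =>
    obtain ⟨m, rfl, rfl⟩ := hstep
    have hm := (c.in_mem_iff m).1 hx
    have := ih (c.out_mem _ hm)
    exact absurd ⟨⟨_, hm⟩, Subtype.ext this⟩ l.2

lemma Cut.leaf_unique (c : T.Cut) {l l' : c.below.leaves} {x : T.E} (h : T.Above x l.1.1)
    (h' : T.Above x l'.1.1) : l = l' := by
  rcases h.total h' with h | h
  · exact Subtype.ext (Subtype.ext (c.eq_of_above_leaf l' l.1.2 h))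
  · exact Subtype.ext (Subtype.ext (c.eq_of_above_leaf l l'.1.2 h)).symm

/-- The first edge of the walk from `x` to the root that lies in the cut is a leaf of the subtree:
if its node belonged to the cut, so would the preceding edge. -/
lemma Cut.exists_leaf (c : T.Cut) {x : T.E} (hx : x ∉ c.edges) :
    ∃ l : c.below.leaves, T.Above x l.1.1 := by
  induction T.reaches x using Relation.ReflTransGen.head_induction_on with
  | refl => exact absurd c.root_mem hx
  | head hstep _ ih =>
    obtain ⟨m, rfl, rfl⟩ := hstep
    by_cases h : T.t (T.p m) ∈ c.edges
    · refine ⟨⟨⟨_, h⟩, ?_⟩, .single ⟨m, rfl, rfl⟩⟩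
      rintro ⟨⟨n, hn⟩, hn'⟩
      obtain rfl : n = T.p m := T.t_inj (Subtype.ext_iff.1 hn')
      exact hx ((c.in_mem_iff m).2 hn)
    · obtain ⟨l, hl⟩ := ih h
      exact ⟨l, .head ⟨m, rfl, rfl⟩ hl⟩

end Cuts

section Graft

variable (S : EffTree) (P : S.leaves → EffTree)

/-- The inclusion of the edges of the tree grafted onto a leaf, the root being identified with the
leaf. -/
def inc (l : S.leaves) (e : (P l).E) : S.E ⊕ Σ l, (P l).M :=
  ((P l).optionEquivE.symm e).elim (.inl l.1) fun m => .inr ⟨l, m⟩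

lemma inc_root (l : S.leaves) : inc S P l (P l).root = .inl l.1 := by
  rw [inc, show (P l).root = (P l).optionEquivE none from rfl, Equiv.symm_apply_apply]
  rfl

lemma inc_s (l : S.leaves) (m : (P l).M) : inc S P l ((P l).s m) = .inr ⟨l, m⟩ := by
  rw [inc, show (P l).s m = (P l).optionEquivE (some m) from rfl, Equiv.symm_apply_apply]
  rfl

variable {S P}

lemma root_or_s (T : EffTree) (e : T.E) : e = T.root ∨ ∃ m, e = T.s m := by
  by_cases h : e = T.root
  · exact .inl h
  · obtain ⟨m, hm⟩ := exists_s h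
    exact .inr ⟨m, hm.symm⟩

/-- Roots go to distinct leaves of `S`, and all other edges keep the tag `l`. Hence the grafted
trees do not overlap. -/
lemma inc_inj {l l' : S.leaves} {e : (P l).E} {e' : (P l').E}
    (h : inc S P l e = inc S P l' e') : (⟨l, e⟩ : Σ l, (P l).E) = ⟨l', e'⟩ := by
  obtain rfl | ⟨m, rfl⟩ := root_or_s _ e <;> obtain rfl | ⟨m', rfl⟩ := root_or_s _ e'
  · rw [inc_root, inc_root] at h
    obtain rfl : l = l' := Subtype.ext (Sum.inl_injective h)
    rfl
  · simp [inc_root, inc_s] at h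
  · simp [inc_root, inc_s] at h
  · rw [inc_s, inc_s] at h
    cases h
    rfl

lemma inc_injective (l : S.leaves) : Function.Injective (inc S P l) := fun _ _ h =>
  eq_of_heq (Sigma.ext_iff.1 (inc_inj h)).2

lemma inc_ne_t {l : S.leaves} {e : (P l).E} {n : S.N} : inc S P l e ≠ .inl (S.t n) := by
  obtain rfl | ⟨m, rfl⟩ := root_or_s _ e
  · rw [inc_root]
    intro h
    exact l.2 ⟨n, (Sum.inl_injective h).symm⟩
  · simp [inc_s]

variable (S P)

/-- The tree obtained by grafting a tree onto each leaf of `S`. -/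
def graft : EffTree where
  E := S.E ⊕ Σ l, (P l).M
  M := S.M ⊕ Σ l, (P l).M
  N := S.N ⊕ Σ l, (P l).N
  s := Sum.map S.s id
  p := Sum.map S.p (Sigma.map id fun l => (P l).p)
  t := Sum.elim (fun n => .inl (S.t n)) fun n => inc S P n.1 ((P n.1).t n.2)
  root := .inl S.root
  t_inj := by
    rintro (n | ⟨l, n⟩) (n' | ⟨l', n'⟩) h
    · exact congrArg _ (S.t_inj (Sum.inl_injective h))
    · exact absurd h.symm inc_ne_t
    · exact absurd h inc_ne_t
    · obtain rfl : l = l' := (Sigma.ext_iff.1 (inc_inj h)).1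
      exact congrArg (fun n => Sum.inr (Sigma.mk l n)) ((P l).t_inj (inc_injective l h))
  s_inj := S.s_inj.sumMap Function.injective_id
  range_s := by
    ext (e | x)
    · have : e ∈ Set.range S.s ↔ e ∈ ({S.root}ᶜ : Set S.E) := by rw [S.range_s]
      simpa using this
    · simp
  reaches := by
    have hl (e : S.E) : Relation.ReflTransGen (Step (Sum.map S.s id)
        (Sum.map S.p (Sigma.map id fun l => (P l).p))
        (Sum.elim (fun n => .inl (S.t n)) fun n : Σ l, (P l).N => inc S P n.1 ((P n.1).t n.2)))
        (.inl e : S.E ⊕ Σ l, (P l).M) (.inl S.root) := by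
      induction S.reaches e using Relation.ReflTransGen.head_induction_on with
      | refl => exact .refl
      | head h _ ih =>
        obtain ⟨m, rfl, rfl⟩ := h
        exact .head ⟨.inl m, rfl, rfl⟩ ih
    rintro (e | ⟨l, m⟩)
    · exact hl e
    -- Viewed as an edge of `P l`, it walks to the root of `P l`, which is the leaf `l` of `S`; from
    -- there the walk continues in `S`.
    · rw [← inc_s]
      generalize (P l).s m = e
      induction (P l).reaches e using Relation.ReflTransGen.head_induction_on with
      | refl =>
        rw [inc_root]
        exact hl _
      | head h _ ih =>
        obtain ⟨m, rfl, rfl⟩ := h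
        exact .head ⟨.inr ⟨l, m⟩, (inc_s S P l m).symm, rfl⟩ ih
  p_surj := by
    rintro (n | ⟨l, n⟩)
    · obtain ⟨m, rfl⟩ := S.p_surj n
      exact ⟨.inl m, rfl⟩
    · obtain ⟨m, rfl⟩ := (P l).p_surj n
      exact ⟨.inr ⟨l, m⟩, rfl⟩

/-- The leaves of a grafted tree. -/
def graftLeaves : (Σ l, (P l).leaves) ≃ (graft S P).leaves :=
  Equiv.ofBijective (fun x => ⟨inc S P x.1 x.2.1, by
    rintro ⟨n | ⟨l, n⟩, h⟩
    · exact inc_ne_t h.symm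
    · obtain ⟨l', e, he⟩ := x
      obtain ⟨rfl, h⟩ := Sigma.ext_iff.1 (inc_inj h)
      exact he ⟨n, eq_of_heq h⟩⟩) <| by
    constructor
    · rintro ⟨l, e⟩ ⟨l', e'⟩ h
      obtain ⟨rfl, h⟩ := Sigma.ext_iff.1 (inc_inj (Subtype.ext_iff.1 h))
      exact Sigma.ext rfl (heq_of_eq (Subtype.ext (eq_of_heq h)))
    · have key (l : S.leaves) (e : (P l).E) (h : inc S P l e ∈ (graft S P).leaves) :
          e ∈ (P l).leaves := by
        rintro ⟨n, rfl⟩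
        exact h ⟨.inr ⟨l, n⟩, rfl⟩
      rintro ⟨e | ⟨l, m⟩, h⟩
      · have he : e ∈ S.leaves := by
          rintro ⟨n, rfl⟩
          exact h ⟨.inl n, rfl⟩
        -- A leaf of `S` is the root of the tree grafted there. It remains a leaf only if that root
        -- is a leaf of its own tree.
        rw [← inc_root S P ⟨e, he⟩] at h
        exact ⟨⟨_, _, key _ _ h⟩, Subtype.ext (inc_root S P ⟨e, he⟩)⟩
      · rw [← inc_s S P] at h
        exact ⟨⟨_, _, key _ _ h⟩, Subtype.ext (inc_s S P l m)⟩

lemma card_leaves_graft [Fintype S.leaves] :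
    Nat.card (graft S P).leaves = ∑ l, Nat.card (P l).leaves := by
  rw [← Nat.card_congr (graftLeaves S P), Nat.card_sigma]

end Graft

/-! ### Isomorphisms from a grafted tree as decompositions along a cut -/

section Decompose

variable (S : EffTree) (P : S.leaves → EffTree) (T : EffTree)

/-- A cut of `T` with identifications of the trees below and above the cut. -/
abbrev Decomposition := Σ x : (Σ c : T.Cut, Iso S c.below),
  ∀ l : S.leaves, Iso (P l) (T.ideal (x.2.onE l.1).1)

variable {S P T}

/-- The leaf of the subtree of a cut corresponding to a leaf of `S`. -/
def leafAt {c : T.Cut} (α : Iso S c.below) (l : S.leaves) : c.below.leaves :=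
  ⟨α.onE l.1, (α.mem_leaves _).1 l.2⟩

lemma leafAt_bijective {c : T.Cut} (α : Iso S c.below) : Function.Bijective (leafAt α) :=
  (Equiv.subtypeEquiv α.onE α.mem_leaves).bijective

namespace Decomposition

variable (D : Decomposition S P T)

/-- The map on edges defined by a decomposition. -/
def mapE : (graft S P).E → T.E :=
  Sum.elim (fun e => (D.1.2.onE e).1) fun m => T.s ((D.2 m.1).onM m.2).1

lemma mapE_inc (l : S.leaves) (e : (P l).E) : D.mapE (inc S P l e) = ((D.2 l).onE e).1 := by
  obtain rfl | ⟨m, rfl⟩ := root_or_s _ e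
  · rw [inc_root, Iso.onE_root]
    rfl
  · rw [inc_s, Iso.comm_s]
    rfl

/-- Each edge of `T` lies in the cut or above exactly one leaf of the subtree, by `exists_leaf` and
`leaf_unique`. -/
lemma mapE_bijective : Function.Bijective D.mapE := by
  -- An edge of the cut above the leaf `l` equals that leaf, which corresponds to the root of `P l`
  -- and not to a marked input.
  have hout (l : S.leaves) (m : (P l).M) : T.s ((D.2 l).onM m).1 ∉ D.1.1.edges := by
    intro h
    have ha : T.Above (T.s ((D.2 l).onM m).1) (leafAt D.1.2 l).1.1 :=
      .head ⟨_, rfl, rfl⟩ ((D.2 l).onM m).2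
    have hs := (D.2 l).comm_s m
    have : (D.2 l).onE ((P l).s m) = (D.2 l).onE (P l).root := by
      rw [hs, Iso.onE_root]
      exact Subtype.ext (D.1.1.eq_of_above_leaf _ h ha)
    exact s_ne_root m ((D.2 l).onE.injective this)
  constructor
  · rintro (e | ⟨l, m⟩) (e' | ⟨l', m'⟩) h
    · exact congrArg _ (D.1.2.onE.injective (Subtype.ext h))
    · exact absurd (Set.mem_of_eq_of_mem h.symm (D.1.2.onE e).2) (hout l' m')
    · exact absurd (Set.mem_of_eq_of_mem h (D.1.2.onE e').2) (hout l m)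
    · have h' := T.s_inj h
      obtain rfl : l = l' := by
        apply (leafAt_bijective D.1.2).1
        apply D.1.1.leaf_unique ((D.2 l).onM m).2
        rw [h']
        exact ((D.2 l').onM m').2
      exact congrArg (fun m => Sum.inr (Sigma.mk l m)) ((D.2 l).onM.injective (Subtype.ext h'))
  · intro x
    by_cases hx : x ∈ D.1.1.edges
    · exact ⟨.inl (D.1.2.onE.symm ⟨x, hx⟩), 
        congrArg Subtype.val (D.1.2.onE.apply_symm_apply ⟨x, hx⟩)⟩
    · obtain ⟨l, hl⟩ := D.1.1.exists_leaf hx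
      obtain ⟨l, rfl⟩ := (leafAt_bijective D.1.2).2 l
      exact ⟨inc S P l ((D.2 l).onE.symm ⟨x, hl⟩), (D.mapE_inc l _).trans
        (congrArg Subtype.val ((D.2 l).onE.apply_symm_apply ⟨x, hl⟩))⟩

/-- The isomorphism from the grafted tree defined by a decomposition. -/
def toIso : Iso (graft S P) T :=
  Iso.ofBijective D.mapE
    (Sum.elim (fun m => (D.1.2.onM m).1) fun m => ((D.2 m.1).onM m.2).1)
    (Sum.elim (fun n => (D.1.2.onN n).1) fun n => ((D.2 n.1).onN n.2).1)
    D.mapE_bijective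
    (by
      rintro (m | ⟨l, m⟩)
      · exact congrArg Subtype.val (D.1.2.comm_s m)
      · rfl)
    (by
      rintro (m | ⟨l, m⟩)
      · exact congrArg Subtype.val (D.1.2.comm_p m)
      · exact congrArg Subtype.val ((D.2 l).comm_p m))
    (by
      rintro (n | ⟨l, n⟩)
      · exact congrArg Subtype.val (D.1.2.comm_t n)
      · exact (D.mapE_inc l _).trans (congrArg Subtype.val ((D.2 l).comm_t n)))

lemma toIso_onE (x : (graft S P).E) : D.toIso.onE x = D.mapE x := rfl

/-- The cut is recovered as the image of the edges of `S`; the isomorphisms are then determined by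
their values on edges. -/
lemma toIso_injective : Function.Injective (toIso : Decomposition S P T → _) := by
  intro D D' h
  have hE (x) : D.mapE x = D'.mapE x := by rw [← toIso_onE, h, toIso_onE]
  obtain ⟨⟨c, α⟩, β⟩ := D
  obtain ⟨⟨c', α'⟩, β'⟩ := D'
  have hα (e : S.E) : (α.onE e).1 = (α'.onE e).1 := hE (.inl e)
  obtain rfl : c = c' := by
    apply Cut.ext_edges
    ext x
    constructor
    · intro hx
      obtain ⟨e, he⟩ := α.onE.surjective ⟨x, hx⟩
      have := hα e
      rw [he] at this
      change x = _ at this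
      rw [this]
      exact (α'.onE e).2
    · intro hx
      obtain ⟨e, he⟩ := α'.onE.surjective ⟨x, hx⟩
      have := hα e
      rw [he] at this
      change _ = x at this
      rw [← this]
      exact (α.onE e).2
  obtain rfl : α = α' := Iso.ext_onE fun e => Subtype.ext (hα e)
  refine Sigma.ext rfl (heq_of_eq (funext fun l => Iso.ext_onE fun e => Subtype.ext ?_))
  have := hE (inc S P l e)
  rwa [mapE_inc, mapE_inc] at this

end Decomposition

section OfIso

variable (γ : Iso (graft S P) T)

/-- The cut of a tree isomorphic to a grafted tree. -/
def cutOfIso : T.Cut where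
  edges := Set.range fun e => γ.onE (.inl e)
  nodes := Set.range fun n => γ.onN (.inl n)
  root_mem := ⟨S.root, γ.onE_root⟩
  out_mem := by
    rintro _ ⟨n, rfl⟩
    exact ⟨S.t n, γ.comm_t (.inl n)⟩
  in_mem_iff m := by
    obtain ⟨m, rfl⟩ := γ.onM.surjective m
    rw [← γ.comm_s, ← γ.comm_p]
    obtain m | ⟨l, m⟩ := m
    · exact iff_of_true ⟨S.s m, rfl⟩ ⟨S.p m, rfl⟩
    · refine iff_of_false ?_ ?_
      · rintro ⟨e, he⟩
        exact Sum.inl_ne_inr (γ.onE.injective he)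
      · rintro ⟨n, hn⟩
        exact Sum.inl_ne_inr (γ.onN.injective hn)

/-- The identification of the subtree of the cut. -/
def belowOfIso : Iso S (cutOfIso γ).below :=
  Iso.ofBijective (U := (cutOfIso γ).below) (fun e => ⟨γ.onE (.inl e), e, rfl⟩)
    (fun m => ⟨γ.onM (.inl m), S.p m, γ.comm_p (.inl m)⟩)
    (fun n => ⟨γ.onN (.inl n), n, rfl⟩)
    ⟨fun _ _ h => Sum.inl_injective (γ.onE.injective (Subtype.ext_iff.1 h)),
      by rintro ⟨_, e, rfl⟩; exact ⟨e, rfl⟩⟩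
    (fun m => Subtype.ext (γ.comm_s (.inl m))) (fun m => Subtype.ext (γ.comm_p (.inl m)))
    fun n => Subtype.ext (γ.comm_t (.inl n))

lemma above_inc (l : S.leaves) (e : (P l).E) : T.Above (γ.onE (inc S P l e)) (γ.onE (.inl l.1)) := by
  induction (P l).reaches e using Relation.ReflTransGen.head_induction_on with
  | refl =>
    rw [inc_root]
    exact .refl
  | head h _ ih =>
    obtain ⟨m, rfl, rfl⟩ := h
    refine .head ⟨γ.onM (.inr ⟨l, m⟩), ?_, ?_⟩ ih
    · rw [inc_s]
      exact (γ.comm_s (.inr ⟨l, m⟩)).symm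
    · exact (congrArg T.t (γ.comm_p (.inr ⟨l, m⟩)).symm).trans
        (γ.comm_t (.inr ⟨l, (P l).p m⟩)).symm

/-- Climbing from the leaf `l` never leaves `P l`: a node whose output edge comes from `P l` cannot
be a node of `S`, nor of another grafted tree. -/
lemma exists_inc_of_above (l : S.leaves) {x : T.E} (h : T.Above x (γ.onE (.inl l.1))) :
    ∃ e, γ.onE (inc S P l e) = x := by
  induction h using Relation.ReflTransGen.head_induction_on with
  | refl => exact ⟨(P l).root, congrArg _ (inc_root S P l)⟩
  | head h _ ih =>
    obtain ⟨m, rfl, rfl⟩ := h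
    obtain ⟨e, he⟩ := ih
    obtain ⟨m, rfl⟩ := γ.onM.surjective m
    rw [← γ.comm_p, ← γ.comm_t] at he
    have he := γ.onE.injective he
    obtain m | ⟨l', m⟩ := m
    · exact absurd he inc_ne_t
    · obtain ⟨rfl, -⟩ := Sigma.ext_iff.1 (inc_inj he)
      exact ⟨_, (congrArg _ (inc_s S P l m)).trans (γ.comm_s (.inr ⟨l, m⟩))⟩

/-- The identification of the trees above the cut. -/
def aboveOfIso (l : S.leaves) : Iso (P l) (T.ideal (γ.onE (.inl l.1))) :=
  have ht (n : (P l).N) : γ.onE (inc S P l ((P l).t n)) = T.t (γ.onN (.inr ⟨l, n⟩)) :=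
    γ.comm_t (.inr ⟨l, n⟩)
  have hp (m : (P l).M) : γ.onN (.inr ⟨l, (P l).p m⟩) = T.p (γ.onM (.inr ⟨l, m⟩)) :=
    γ.comm_p (.inr ⟨l, m⟩)
  Iso.ofBijective (U := T.ideal (γ.onE (.inl l.1)))
    (fun e => ⟨γ.onE (inc S P l e), above_inc γ l e⟩)
    (fun m => ⟨γ.onM (.inr ⟨l, m⟩), by
      rw [← hp, ← ht]
      exact above_inc γ l _⟩)
    (fun n => ⟨γ.onN (.inr ⟨l, n⟩), by
      rw [← ht]
      exact above_inc γ l _⟩)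
    ⟨fun _ _ h => inc_injective l (γ.onE.injective (Subtype.ext_iff.1 h)), by
      rintro ⟨x, hx⟩
      obtain ⟨e, rfl⟩ := exists_inc_of_above γ l hx
      exact ⟨e, rfl⟩⟩
    (fun m => Subtype.ext ((congrArg _ (inc_s S P l m)).trans (γ.comm_s (.inr ⟨l, m⟩))))
    (fun m => Subtype.ext (hp m)) fun n => Subtype.ext (ht n)

end OfIso

lemma Decomposition.toIso_surjective :
    Function.Surjective (toIso : Decomposition S P T → _) := by
  intro γ
  refine ⟨⟨⟨cutOfIso γ, belowOfIso γ⟩, aboveOfIso γ⟩, Iso.ext_onE ?_⟩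
  rintro (e | ⟨l, m⟩)
  · rfl
  · exact (γ.comm_s (.inr ⟨l, m⟩)).symm

lemma card_decomposition :
    Nat.card (Decomposition S P T) = Nat.card (Iso (graft S P) T) :=
  Nat.card_congr (Equiv.ofBijective _
    ⟨Decomposition.toIso_injective, Decomposition.toIso_surjective⟩)

end Decompose

end EffTree

/-! ### Counting cuts -/

instance (S : EffTree) : Fintype S.leaves := Fintype.ofFinite _

instance (T : EffTree) : Fintype T.Cut := Fintype.ofFinite _

instance (T U : EffTree) : Fintype (EffTree.Iso T U) := Fintype.ofFinite _

/-- The inverse of an isomorphism of trees. -/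
def EffTree.Iso.symm {T U : EffTree} (f : EffTree.Iso T U) : EffTree.Iso U T :=
  Groupoid.inv (show T ⟶ U from f)

section Counting

open Classical

variable {S T : EffTree}

/-- The classes of the trees above a cut, indexed by the leaves of a tree identified with the
subtree of the cut. -/
def typeOf (x : Σ c : T.Cut, EffTree.Iso S c.below) (l : S.leaves) : Pi0 EffTree :=
  cls (T.ideal (x.2.onE l.1).1)

/-- For a cut with an identification of its lower tree, the families of isomorphisms from the `φ l`
to the upper trees number `∏ |Aut (φ l)|` if the types match, and zero otherwise. Summing counts
decompositions, that is, isomorphisms from the grafted tree. -/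
lemma card_typeOf (S : EffTree) (φ : S.leaves → Pi0 EffTree) (x : Pi0 EffTree) :
    ((Finset.univ.filter fun y : Σ c : x.out.Cut, EffTree.Iso S c.below => typeOf y = φ).card : ℚ) *
      ∏ l, autCard (φ l) = if cls (S.graft fun l => (φ l).out) = x then autCard x else 0 := by
  have h1 : (Nat.card (EffTree.Iso (S.graft fun l => (φ l).out) x.out) : ℚ) =
      if cls (S.graft fun l => (φ l).out) = x then autCard x else 0 := by
    rw [EffTree.card_iso]
    split_ifs with h
    · rw [card_iso_of_cls_eq (by rw [h, cls_out]), autCard]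
    · rw [card_iso_of_cls_ne (by rwa [cls_out]), Nat.cast_zero]
  rw [← h1, ← EffTree.card_decomposition, Nat.card_sigma, Nat.cast_sum, Finset.card_filter,
    Nat.cast_sum, Finset.sum_mul]
  refine Finset.sum_congr rfl fun y _ => ?_
  rw [Nat.card_pi, Nat.cast_prod]
  simp only [EffTree.card_iso_out]
  split_ifs with h
  · subst h
    rw [Nat.cast_one, one_mul]
    exact Finset.prod_congr rfl fun l _ => (if_pos rfl).symm
  · obtain ⟨l, hl⟩ := Function.ne_iff.1 h
    rw [Nat.cast_zero, zero_mul, Finset.prod_eq_zero (Finset.mem_univ l)]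
    exact if_neg hl

/-- The monomial `δ_{P_c} ⊗ δ_{S_c}` of a cut. -/
def cutMon (c : T.Cut) : Pi0 EffTree ⊕ Pi0 EffTree →₀ ℕ :=
  ∑ e : c.below.leaves, Finsupp.single (Sum.inl (cls (T.ideal e.1.1))) 1 +
    Finsupp.single (Sum.inr (cls c.below)) 1

/-- The monomial `∏ δ_{φ l} ⊗ δ_y`. -/
def graftMon (y : Pi0 EffTree) (φ : y.out.leaves → Pi0 EffTree) :
    Pi0 EffTree ⊕ Pi0 EffTree →₀ ℕ :=
  ∑ l, Finsupp.single (Sum.inl (φ l)) 1 + Finsupp.single (Sum.inr y) 1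

lemma cutMon_eq_graftMon (y : Pi0 EffTree) (x : Σ c : T.Cut, EffTree.Iso y.out c.below) :
    cutMon x.1 = graftMon y (typeOf x) := by
  have : cls x.1.below = y := cls_eq_iff.2 ⟨x.2.symm⟩
  rw [cutMon, graftMon, this,
    ← Function.Bijective.sum_comp (EffTree.leafAt_bijective x.2)]
  rfl

lemma graftMon_inr (y z : Pi0 EffTree) (φ : y.out.leaves → Pi0 EffTree) :
    graftMon y φ (Sum.inr z) = if y = z then 1 else 0 := by
  simp [graftMon, Finsupp.single_apply]

lemma exists_graftMon_eq_cutMon (c : T.Cut) : ∃ y φ, cutMon c = graftMon y φ := by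
  obtain ⟨α⟩ := cls_eq_iff.1 (rfl : cls c.below = _)
  exact ⟨_, _, cutMon_eq_graftMon (cls c.below) ⟨c, α.symm⟩⟩

/-- A cut with lower tree in the class `y` has `|Aut y|` identifications with `y.out`. Each turns
its upper trees into a labelling of the leaves of `y.out`, and the monomial forgets exactly this
choice. -/
lemma card_cut (T : EffTree) (y : Pi0 EffTree) (s : Finset (y.out.leaves → Pi0 EffTree))
    (φ₀ : y.out.leaves → Pi0 EffTree) (hs : ∀ φ, φ ∈ s ↔ graftMon y φ = graftMon y φ₀) :
    ((Finset.univ.filter fun c : T.Cut => cutMon c = graftMon y φ₀).card : ℚ) * autCard y =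
      ∑ φ ∈ s, ((Finset.univ.filter fun x : Σ c : T.Cut, EffTree.Iso y.out c.below =>
        typeOf x = φ).card : ℚ) := by
  have h1 : (Finset.univ.filter fun x : Σ c : T.Cut, EffTree.Iso y.out c.below =>
      cutMon x.1 = graftMon y φ₀).card = ∑ φ ∈ s,
        (Finset.univ.filter fun x : Σ c : T.Cut, EffTree.Iso y.out c.below =>
          typeOf x = φ).card := by
    rw [Finset.card_eq_sum_card_fiberwise (f := typeOf) (t := s)]
    · refine Finset.sum_congr rfl fun φ hφ => congrArg _ ?_
      ext x
      simp only [Finset.mem_filter, Finset.mem_univ, true_and, and_iff_right_iff_imp]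
      rintro rfl
      rw [cutMon_eq_graftMon]
      exact (hs _).1 hφ
    · intro x hx
      rw [Finset.mem_coe, hs, ← cutMon_eq_graftMon]
      simpa using hx
  rw [← Nat.cast_sum, ← h1, Finset.card_filter, Finset.card_filter, Fintype.sum_sigma,
    Nat.cast_sum, Nat.cast_sum, Finset.sum_mul]
  refine Finset.sum_congr rfl fun c _ => ?_
  change _ = ((∑ _α : EffTree.Iso y.out c.below,
    if cutMon c = graftMon y φ₀ then 1 else 0 : ℕ) : ℚ)
  rw [Finset.sum_const, smul_eq_mul, Nat.cast_mul, mul_comm]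
  split_ifs with h
  -- The lower tree gives the only variable from the right-hand copy, so the monomial determines its
  -- class.
  · have hy : cls c.below = y := by
      obtain ⟨α⟩ := cls_eq_iff.1 (rfl : cls c.below = _)
      have := cutMon_eq_graftMon (cls c.below) ⟨c, α.symm⟩
      have := congrArg (fun d => d (Sum.inr y)) (this.symm.trans h)
      simp only [graftMon_inr, if_true] at this
      by_contra hne
      simp [hne] at this
    rw [Finset.card_univ, ← Nat.card_eq_fintype_card, EffTree.card_iso_out, if_pos hy]
  · simp

lemma coeff_treeComulGen (x : Pi0 EffTree) (d : Pi0 EffTree ⊕ Pi0 EffTree →₀ ℕ) :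
    MvPowerSeries.coeff d (treeComulGen x) =
      ((Finset.univ.filter fun c : x.out.Cut => cutMon c = d).card : ℚ) := by
  rw [treeComulGen, finsum_eq_sum_of_fintype, map_sum, Finset.card_filter, Nat.cast_sum]
  refine Finset.sum_congr rfl fun c _ => ?_
  rw [finprod_eq_prod_of_fintype]
  simp only [MvPowerSeries.X]
  rw [MvPowerSeries.prod_monomial, MvPowerSeries.monomial_mul_monomial,
    MvPowerSeries.coeff_monomial, Finset.prod_const_one, one_mul]
  change (if d = cutMon c then _ else _) = _
  simp only [eq_comm (a := d)]
  split_ifs <;> simp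

lemma leafCount_graft (y : Pi0 EffTree) (φ : y.out.leaves → Pi0 EffTree) :
    (leafCount (cls (y.out.graft fun l => (φ l).out)) : ℕ) = ∑ l, (leafCount (φ l) : ℕ) := by
  obtain ⟨α⟩ := cls_eq_iff.1 (rfl : cls (y.out.graft fun l => (φ l).out) = _)
  change Nat.card (cls (y.out.graft fun l => (φ l).out)).out.leaves = _
  rw [← Nat.card_congr (Equiv.subtypeEquiv α.onE α.mem_leaves), EffTree.card_leaves_graft]
  rfl

lemma finite_graftMon (y : Pi0 EffTree) (d : Pi0 EffTree ⊕ Pi0 EffTree →₀ ℕ) :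
    {φ | graftMon y φ = d}.Finite := by
  refine (Set.Finite.pi (t := fun _ => Sum.inl ⁻¹' (d.support : Set (Pi0 EffTree ⊕ Pi0 EffTree)))
    fun _ => d.support.finite_toSet.preimage Sum.inl_injective.injOn).subset ?_
  rintro φ rfl l -
  simp only [Set.mem_preimage, Finset.mem_coe, Finsupp.mem_support_iff]
  rw [graftMon, Finsupp.add_apply, Finsupp.finsetSum_apply]
  have := Finset.single_le_sum (f := fun l' : y.out.leaves =>
    Finsupp.single (Sum.inl (φ l') : Pi0 EffTree ⊕ Pi0 EffTree) 1 (Sum.inl (φ l)))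
    (fun _ _ => Nat.zero_le _) (Finset.mem_univ l)
  simp at this
  omega

/-- The trees grafted on `y` with leaf number `n` and a given monomial, weighted by the
automorphisms of the trees above. -/
def graftSum (n : ℕ) (y : Pi0 EffTree) (d : Pi0 EffTree ⊕ Pi0 EffTree →₀ ℕ) : ℚ :=
  ∑ φ ∈ (finite_graftMon y d).toFinset,
    if ∑ l, (leafCount (φ l) : ℕ) = n then ∏ l, 1 / autCard (φ l) else 0

lemma coeff_treeComul_phiGen (n : ℕ+) (d : Pi0 EffTree ⊕ Pi0 EffTree →₀ ℕ) :
    MvPowerSeries.coeff d (treeComul (phiGen n)) =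
      ∑ᶠ x, (if leafCount x = n then ((leafCount x : ℕ).factorial : ℚ) / autCard x else 0) *
        ((Finset.univ.filter fun c : x.out.Cut => cutMon c = d).card : ℚ) := by
  rw [treeComul, MvPowerSeries.substAlgHom_apply, phiGen_eq,
    coeff_subst_linSeries hasSubst_treeComulGen]
  simp only [coeff_treeComulGen]

/-- The count of cuts becomes a sum over labellings by `card_cut` and `card_typeOf`. After
exchanging the sums, a labelling contributes only at the class of its grafted tree, where the
automorphisms of that tree cancel. -/
lemma coeff_treeComul_phiGen_graftMon (n : ℕ+) (y : Pi0 EffTree)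
    (φ₀ : y.out.leaves → Pi0 EffTree) :
    MvPowerSeries.coeff (graftMon y φ₀) (treeComul (phiGen n)) =
      (n : ℕ).factorial * (1 / autCard y * graftSum n y (graftMon y φ₀)) := by
  have hy := autCard_ne_zero y
  have hs (φ) : φ ∈ (finite_graftMon y (graftMon y φ₀)).toFinset ↔
      graftMon y φ = graftMon y φ₀ := by simp
  have h1 (x : Pi0 EffTree) : (if leafCount x = n then
      ((leafCount x : ℕ).factorial : ℚ) / autCard x else 0) *
        ((Finset.univ.filter fun c : x.out.Cut => cutMon c = graftMon y φ₀).card : ℚ) =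
      ∑ φ ∈ (finite_graftMon y (graftMon y φ₀)).toFinset, (n : ℕ).factorial * (1 / autCard y) *
        if cls (y.out.graft fun l => (φ l).out) = x then
          (if leafCount x = n then ∏ l, 1 / autCard (φ l) else 0) else 0 := by
    rw [eq_div_of_mul_eq hy (card_cut x.out y _ φ₀ hs), ← mul_div_assoc,
      Finset.mul_sum, Finset.sum_div]
    refine Finset.sum_congr rfl fun φ _ => ?_
    have hφ : ∏ l, autCard (φ l) ≠ 0 := Finset.prod_ne_zero_iff.2 fun l _ => autCard_ne_zero _
    rw [eq_div_of_mul_eq hφ (card_typeOf y.out φ x), Finset.prod_div_distrib,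
      Finset.prod_const_one]
    have hx := autCard_ne_zero x
    split_ifs with h1 h2
    · rw [h1]
      field_simp
    · simp
    · simp
    · simp
  rw [coeff_treeComul_phiGen, finsum_congr h1, finsum_sum_comm, graftSum, ← mul_assoc,
    Finset.mul_sum]
  · refine Finset.sum_congr rfl fun φ _ => ?_
    rw [finsum_eq_single _ (cls (y.out.graft fun l => (φ l).out))]
    · rw [if_pos rfl, ← leafCount_graft]
      simp only [PNat.coe_inj]
    · intro x hx
      rw [if_neg hx.symm, mul_zero]
  · intro φ _
    refine (Set.finite_singleton (cls (y.out.graft fun l => (φ l).out))).subset fun x hx => ?_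
    by_contra h
    exact hx ((congrArg _ (if_neg (Ne.symm h))).trans (mul_zero _))

lemma coeff_treeComul_phiGen_eq_zero (n : ℕ+) (d : Pi0 EffTree ⊕ Pi0 EffTree →₀ ℕ)
    (hd : ∀ y φ, d ≠ graftMon y φ) : MvPowerSeries.coeff d (treeComul (phiGen n)) = 0 := by
  rw [coeff_treeComul_phiGen, ← finsum_zero (α := Pi0 EffTree)]
  refine finsum_congr fun x => ?_
  rw [Finset.filter_eq_empty_iff.2, Finset.card_empty, Nat.cast_zero, mul_zero]
  rintro c - rfl
  obtain ⟨y, φ, h⟩ := exists_graftMon_eq_cutMon c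
  exact hd y φ h

end Counting

/-! ### Compatibility with the comultiplications -/

section Comul

open Classical

lemma rename_linSeries {σ τ : Type*} (f : σ ↪ τ) [Filter.TendstoCofinite f] (c : σ → ℚ)
    (c' : τ → ℚ) (h : ∀ i, c' (f i) = c i) (h' : ∀ j, j ∉ Set.range f → c' j = 0) :
    MvPowerSeries.rename f (linSeries c) = linSeries c' := by
  refine linSeries_ext (fun j => ?_) fun d hd => ?_
  · by_cases hj : j ∈ Set.range f
    · obtain ⟨i, rfl⟩ := hj
      have := MvPowerSeries.coeff_embDomain_rename f (linSeries c) (Finsupp.single i 1)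
      rwa [Finsupp.embDomain_single, coeff_linSeries_single, ← h] at this
    · rw [h' j hj]
      by_contra hne
      obtain ⟨e, he, hc⟩ := exists_of_coeff_rename f hne
      obtain ⟨i, rfl, -⟩ := exists_of_coeff_linSeries hc
      rw [Finsupp.mapDomain_single, Finsupp.single_left_inj one_ne_zero] at he
      exact hj ⟨i, he⟩
  · by_contra hne
    obtain ⟨e, he, hc⟩ := exists_of_coeff_rename f hne
    obtain ⟨i, rfl, -⟩ := exists_of_coeff_linSeries hc
    rw [Finsupp.mapDomain_single] at he
    exact hd _ he.symm

lemma coeff_linSeries_mul {σ : Type*} (c : σ → ℚ) (H : MvPowerSeries σ ℚ) (d : σ →₀ ℕ) :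
    MvPowerSeries.coeff d (linSeries c * H) =
      ∑ i ∈ d.support, c i * MvPowerSeries.coeff (d - Finsupp.single i 1) H := by
  have hle {i : σ} (hi : i ∈ d.support) : Finsupp.single i 1 ≤ d :=
    Finsupp.single_le_iff.2 (Nat.one_le_iff_ne_zero.2 (Finsupp.mem_support_iff.1 hi))
  rw [MvPowerSeries.coeff_mul]
  symm
  refine Finset.sum_of_injOn (fun i => (Finsupp.single i 1, d - Finsupp.single i 1)) ?_ ?_ ?_ ?_
  · intro i _ j _ h
    exact Finsupp.single_left_injective one_ne_zero (Prod.ext_iff.1 h).1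
  · intro i hi
    simpa using add_tsub_cancel_of_le (hle hi)
  · rintro ⟨a, b⟩ hab h
    by_contra hne
    obtain ⟨i, rfl, -⟩ := exists_of_coeff_linSeries (left_ne_zero_of_mul hne)
    have hab : Finsupp.single i 1 + b = d := by simpa using hab
    refine h ⟨i, ?_, ?_⟩
    · simp [← hab]
    · simp [← hab]
  · intro i _
    rw [coeff_linSeries_single]

/-- The series `∑ (g_n ⊗ 1) z ^ n`. -/
def greenSeries : PowerSeries (TensorSq (Pi0 EffTree)) :=
  PowerSeries.map (PhiPhi : TensorSq ℕ+ →+* TensorSq (Pi0 EffTree)) (genericSeries Sum.inl)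

lemma smul_phiGen_eq {n : ℕ} {m : ℕ+} (h : (m : ℕ) = n) :
    (1 / (n.factorial : ℚ)) • phiGen m = linSeries fun x =>
      if (leafCount x : ℕ) = n then 1 / autCard x else 0 := by
  subst h
  rw [smul_phiGen, smallG_eq]
  simp only [PNat.coe_inj]

lemma PhiPhi_X (i : ℕ+ ⊕ ℕ+) : PhiPhi (MvPowerSeries.X i) = tensorFamily phiGen i :=
  MvPowerSeries.substAlgHom_X (hasSubst_tensorFamily hasSubst_phiGen) i

lemma coeff_greenSeries (n : ℕ) : PowerSeries.coeff n greenSeries =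
    linSeries (Sum.elim (fun x => if (leafCount x : ℕ) = n then 1 / autCard x else 0) 0) := by
  rw [greenSeries, PowerSeries.coeff_map, genericSeries, PowerSeries.coeff_mk]
  split_ifs with h
  · change PhiPhi _ = _
    rw [map_smul, PhiPhi_X]
    change _ • MvPowerSeries.rename Sum.inl _ = _
    rw [← map_smul]
    refine (congrArg _ (smul_phiGen_eq (m := ⟨n, h⟩) rfl)).trans ?_
    exact rename_linSeries Function.Embedding.inl _ _ (fun _ => rfl) (by simp)
  -- The case `n = 0`: no tree has an empty leaf set.
  · refine (map_zero _).trans (linSeries_ext ?_ ?_)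
    · rintro (x | x)
      · simp [show ¬ (leafCount x : ℕ) = n from fun hx => h (hx ▸ (leafCount x).pos)]
      · simp
    · simp

lemma PhiPhi_coeff_genericSeries_inr (n : ℕ) :
    PhiPhi (PowerSeries.coeff n (genericSeries Sum.inr)) =
    linSeries (Sum.elim 0 fun x => if (leafCount x : ℕ) = n then 1 / autCard x else 0) := by
  rw [genericSeries, PowerSeries.coeff_mk]
  split_ifs with h
  · rw [map_smul, PhiPhi_X]
    change _ • MvPowerSeries.rename Sum.inr _ = _
    rw [← map_smul]
    refine (congrArg _ (smul_phiGen_eq (m := ⟨n, h⟩) rfl)).trans ?_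
    exact rename_linSeries Function.Embedding.inr _ _ (fun _ => rfl) (by simp)
  · refine (map_zero _).trans (linSeries_ext ?_ ?_)
    · rintro (x | x)
      · simp
      · simp [show ¬ (leafCount x : ℕ) = n from fun hx => h (hx ▸ (leafCount x).pos)]
    · simp

/-- All coefficients of the series have degree one, so a non-zero term in the expanded product
chooses one tree for each factor. That choice `φ` determines both the powers of `z` and the
monomials taken from the factors. -/
lemma coeff_greenSeries_pow {ι : Type*} [Fintype ι] (n : ℕ)
    (e : Pi0 EffTree ⊕ Pi0 EffTree →₀ ℕ) (s : Finset (ι → Pi0 EffTree))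
    (hs : ∀ φ, φ ∈ s ↔ ∑ i, Finsupp.single (Sum.inl (φ i)) 1 = e) :
    MvPowerSeries.coeff e (PowerSeries.coeff n (greenSeries ^ Fintype.card ι)) =
      ∑ φ ∈ s, if ∑ i, (leafCount (φ i) : ℕ) = n then ∏ i, 1 / autCard (φ i) else 0 := by
  rw [← Finset.card_univ, ← Finset.prod_const, PowerSeries.coeff_prod, map_sum,
    Finset.sum_congr rfl fun l _ => MvPowerSeries.coeff_prod _ _ _, Finset.sum_sigma',
    ← Finset.sum_filter]
  symm
  refine Finset.sum_of_injOn (fun φ => ⟨Finsupp.equivFunOnFinite.symm fun i => leafCount (φ i),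
    Finsupp.equivFunOnFinite.symm fun i => Finsupp.single (Sum.inl (φ i)) 1⟩) ?_ ?_ ?_ ?_
  · intro φ _ ψ _ h
    obtain ⟨-, h⟩ := Sigma.ext_iff.1 h
    have h := Finsupp.equivFunOnFinite.symm.injective (eq_of_heq h)
    ext1 i
    exact Sum.inl_injective (Finsupp.single_left_injective one_ne_zero (congrFun h i))
  · intro φ hφ
    obtain ⟨h1, h2⟩ := Finset.mem_filter.1 hφ
    simp only [Finset.coe_sigma, Set.mem_sigma_iff, Finset.mem_coe, Finset.mem_finsuppAntidiag]
    exact ⟨⟨h2, Finset.subset_univ _⟩, (hs φ).1 h1, Finset.subset_univ _⟩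
  · rintro ⟨l, m⟩ hlm h
    by_contra hne
    have hi (i : ι) : ∃ x, m i = Finsupp.single (Sum.inl x) 1 ∧ (leafCount x : ℕ) = l i := by
      have := Finset.prod_ne_zero_iff.1 hne i (Finset.mem_univ i)
      rw [coeff_greenSeries] at this
      obtain ⟨x | x, h1, h2⟩ := exists_of_coeff_linSeries this
      · refine ⟨x, h1, ?_⟩
        by_contra hx
        simp [hx] at h2
      · simp at h2
    choose φ h1 h2 using hi
    simp only [Finset.mem_sigma, Finset.mem_finsuppAntidiag] at hlm
    refine h ⟨φ, Finset.mem_coe.2 (Finset.mem_filter.2 ⟨(hs φ).2 ?_, ?_⟩), ?_⟩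
    · rw [← hlm.2.1]
      exact Finset.sum_congr rfl fun i _ => (h1 i).symm
    · rw [← hlm.1.1]
      exact Finset.sum_congr rfl fun i _ => h2 i
    · refine Sigma.ext (Finsupp.ext h2) (heq_of_eq (Finsupp.ext fun i => (h1 i).symm))
  · intro φ _
    refine Finset.prod_congr rfl fun i _ => ?_
    change _ = MvPowerSeries.coeff (Finsupp.single (Sum.inl (φ i)) 1)
      (PowerSeries.coeff (leafCount (φ i) : ℕ) greenSeries)
    rw [coeff_greenSeries, coeff_linSeries_single, Sum.elim_inl, if_pos rfl]

lemma coeff_PhiPhi_faaComulGen (n : ℕ+) (d : Pi0 EffTree ⊕ Pi0 EffTree →₀ ℕ) :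
    MvPowerSeries.coeff d (PhiPhi (faaComulGen n)) = (n : ℕ).factorial *
      ∑ᶠ k : ℕ, ∑ i ∈ d.support,
        Sum.elim (0 : Pi0 EffTree → ℚ)
            (fun x => if (leafCount x : ℕ) = k then 1 / autCard x else 0) i *
          MvPowerSeries.coeff (d - Finsupp.single i 1)
            (PowerSeries.coeff (n : ℕ) (greenSeries ^ k)) := by
  rw [faaComulGen, map_smul, MvPowerSeries.coeff_smul,
    PowerSeries.coeff_subst' (hasSubst_genericSeries _)]
  congr 1
  -- The inner series has no constant term, so only finitely many `k` contribute to `z ^ n` and a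
  -- linear map may be applied termwise.
  have h := map_finsum ((MvPowerSeries.coeff (R := ℚ) d).comp PhiPhi.toLinearMap)
    (PowerSeries.coeff_subst_finite' (hasSubst_genericSeries Sum.inl)
      (genericSeries Sum.inr) (n : ℕ))
  refine h.trans (finsum_congr fun k => ?_)
  rw [← coeff_linSeries_mul, ← PhiPhi_coeff_genericSeries_inr, greenSeries, ← map_pow,
    PowerSeries.coeff_map, smul_eq_mul]
  exact congrArg (MvPowerSeries.coeff d) (map_mul PhiPhi _ _)

lemma leafCount_eq_card (y : Pi0 EffTree) : (leafCount y : ℕ) = Fintype.card y.out.leaves :=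
  Nat.card_eq_fintype_card

/-- The outer factor must supply the variable `1 ⊗ δ_y`, which fixes the power `k` as the number of
leaves of `y`. The `k` inner factors then label these leaves. -/
lemma coeff_PhiPhi_faaComulGen_graftMon (n : ℕ+) (y : Pi0 EffTree)
    (φ₀ : y.out.leaves → Pi0 EffTree) :
    MvPowerSeries.coeff (graftMon y φ₀) (PhiPhi (faaComulGen n)) =
      (n : ℕ).factorial * (1 / autCard y * graftSum n y (graftMon y φ₀)) := by
  have hy : Sum.inr y ∈ (graftMon y φ₀).support := by simp [graftMon_inr]
  have h (k : ℕ) : ∑ i ∈ (graftMon y φ₀).support,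
      Sum.elim (0 : Pi0 EffTree → ℚ) (fun x => if (leafCount x : ℕ) = k then 1 / autCard x else 0) i *
        MvPowerSeries.coeff (graftMon y φ₀ - Finsupp.single i 1)
          (PowerSeries.coeff (n : ℕ) (greenSeries ^ k)) =
      (if (leafCount y : ℕ) = k then 1 / autCard y else 0) *
        MvPowerSeries.coeff (∑ l, Finsupp.single (Sum.inl (φ₀ l)) 1)
          (PowerSeries.coeff (n : ℕ) (greenSeries ^ k)) := by
    rw [Finset.sum_eq_single_of_mem _ hy]
    · rw [graftMon, add_tsub_cancel_right, Sum.elim_inr]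
    · rintro (z | z) hz hne
      · simp
      · have : y ≠ z := fun h => hne (by rw [h])
        simp [graftMon_inr, this] at hz
  rw [coeff_PhiPhi_faaComulGen, finsum_congr h, finsum_eq_single _ (leafCount y : ℕ)]
  · rw [if_pos rfl, leafCount_eq_card, graftSum, coeff_greenSeries_pow]
    intro φ
    simp [graftMon]
  · intro k hk
    rw [if_neg hk.symm, zero_mul]

lemma coeff_PhiPhi_faaComulGen_eq_zero (n : ℕ+) (d : Pi0 EffTree ⊕ Pi0 EffTree →₀ ℕ)
    (hd : ∀ y φ, d ≠ graftMon y φ) : MvPowerSeries.coeff d (PhiPhi (faaComulGen n)) = 0 := by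
  rw [coeff_PhiPhi_faaComulGen, finsum_eq_zero_of_forall_eq_zero, mul_zero]
  refine fun k => Finset.sum_eq_zero ?_
  rintro (z | y) hi
  · simp
  · rw [Sum.elim_inr]
    split_ifs with hk
    · rw [← hk, leafCount_eq_card, coeff_greenSeries_pow (ι := y.out.leaves) _ _ ∅,
        Finset.sum_empty, mul_zero]
      intro φ
      refine iff_of_false (Finset.notMem_empty _) fun h => hd y φ ?_
      rw [graftMon, h, tsub_add_cancel_of_le]
      exact Finsupp.single_le_iff.2 (Nat.one_le_iff_ne_zero.2 (Finsupp.mem_support_iff.1 hi))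
    · rw [zero_mul]

lemma treeComul_phiGen (n : ℕ+) : treeComul (phiGen n) = PhiPhi (faaComulGen n) := by
  ext d
  by_cases hd : ∃ y φ, d = graftMon y φ
  · obtain ⟨y, φ, rfl⟩ := hd
    rw [coeff_treeComul_phiGen_graftMon, coeff_PhiPhi_faaComulGen_graftMon]
  · push Not at hd
    rw [coeff_treeComul_phiGen_eq_zero n d hd, coeff_PhiPhi_faaComulGen_eq_zero n d hd]

/-- Both composites are again substitutions, so agreement on the generators suffices. -/
lemma treeComul_Phi (f : FaaDiBruno) : treeComul (Phi f) = PhiPhi (faaComul f) := by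
  have h (n : ℕ+) : MvPowerSeries.subst treeComulGen (phiGen n) =
      MvPowerSeries.subst (tensorFamily phiGen) (faaComulGen n) := by
    have := treeComul_phiGen n
    rwa [treeComul, MvPowerSeries.substAlgHom_apply, PhiPhi, tensorHom,
      MvPowerSeries.substAlgHom_apply] at this
  rw [treeComul, Phi, PhiPhi, faaComul, tensorHom]
  simp only [MvPowerSeries.substAlgHom_apply]
  rw [MvPowerSeries.subst_comp_subst_apply hasSubst_phiGen hasSubst_treeComulGen,
    MvPowerSeries.subst_comp_subst_apply hasSubst_faaComulGen
      (hasSubst_tensorFamily hasSubst_phiGen)]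
  simp only [h]

end Comul

/-! ### Compatibility with the counits -/

section Counit

lemma finsum_comp_of_support_subset {α β : Type*} {F : β → ℚ} {j : α → β}
    (hj : Function.Injective j) (h : Function.support F ⊆ Set.range j) :
    ∑ᶠ b, F b = ∑ᶠ a, F (j a) := by
  rw [← finsum_mem_univ, finsum_mem_inter_support_eq' _ _ (Set.range j), finsum_mem_range hj]
  exact fun b hb => iff_of_true trivial (h hb)

/-- For a counit which is `1` on the variable `i₀` and vanishes on the others. -/
lemma counitValue_iff {σ : Type*} {ε : σ → ℚ} (i₀ : σ) (h₀ : ε i₀ = 1)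
    (h : ∀ i, i ≠ i₀ → ε i = 0) (f : MvPowerSeries σ ℚ) (r : ℚ) :
    CounitValue ε f r ↔
      (Function.support fun k => MvPowerSeries.coeff (Finsupp.single i₀ k) f).Finite ∧
        ∑ᶠ k, MvPowerSeries.coeff (Finsupp.single i₀ k) f = r := by
  have hinj : Function.Injective fun k : ℕ => Finsupp.single i₀ k := Finsupp.single_injective i₀
  have hF (k : ℕ) : MvPowerSeries.coeff (Finsupp.single i₀ k) f *
      (Finsupp.single i₀ k).prod (fun i k => ε i ^ k) =
        MvPowerSeries.coeff (Finsupp.single i₀ k) f := by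
    rw [Finsupp.prod_single_index (h := fun i k => ε i ^ k) (pow_zero _), h₀, one_pow, mul_one]
  -- A monomial involving any variable other than `i₀` has counit zero.
  have hsupp : (Function.support fun d : σ →₀ ℕ =>
      MvPowerSeries.coeff d f * d.prod fun i k => ε i ^ k) ⊆
        Set.range fun k : ℕ => Finsupp.single i₀ k := by
    intro d hd
    refine ⟨d i₀, ?_⟩
    ext i
    by_cases hi : i = i₀
    · subst hi
      simp
    · rw [Finsupp.single_eq_of_ne hi]
      by_contra hne
      refine right_ne_zero_of_mul hd (Finset.prod_eq_zero (i := i) ?_ ?_)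
      · exact Finsupp.mem_support_iff.2 (Ne.symm hne)
      · exact (congrArg (· ^ d i) (h i hi)).trans (zero_pow (Ne.symm hne))
  have hpre : (Function.support fun k : ℕ => MvPowerSeries.coeff (Finsupp.single i₀ k) f) =
      (fun k : ℕ => Finsupp.single i₀ k) ⁻¹' (Function.support fun d : σ →₀ ℕ =>
        MvPowerSeries.coeff d f * d.prod fun i k => ε i ^ k) := by
    ext k
    simp only [Set.mem_preimage, Function.mem_support, hF]
  refine and_congr ?_ ?_
  · rw [hpre]
    refine ⟨fun h => h.preimage hinj.injOn, fun h => (h.image fun k => Finsupp.single i₀ k).subset ?_⟩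
    rw [Set.image_preimage_eq_inter_range]
    exact fun d hd => ⟨hd, hsupp hd⟩
  · rw [finsum_comp_of_support_subset hinj hsupp]
    simp only [hF]

/-- The tree without nodes. -/
def trivialTree : EffTree where
  E := Unit
  M := Empty
  N := Empty
  s := Empty.elim
  p := Empty.elim
  t := Empty.elim
  root := ()
  t_inj := fun x => x.elim
  s_inj := fun x => x.elim
  range_s := by ext; simp
  reaches := fun _ => .refl
  p_surj := fun x => x.elim

lemma isEmpty_M {T : EffTree} (h : IsEmpty T.N) : IsEmpty T.M := ⟨fun m => h.elim (T.p m)⟩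

lemma card_E_of_isEmpty {T : EffTree} (h : IsEmpty T.N) : Nat.card T.E = 1 := by
  have := isEmpty_M h
  rw [EffTree.card_E, Nat.card_of_isEmpty]

lemma cls_trivialTree_iff (x : Pi0 EffTree) : IsEmpty x.out.N ↔ x = cls trivialTree := by
  constructor
  · intro h
    have hM := isEmpty_M h
    have hE := card_E_of_isEmpty h
    rw [Nat.card_eq_one_iff_unique] at hE
    obtain ⟨_, _⟩ := hE
    refine (cls_eq_iff.2 ⟨EffTree.Iso.ofBijective (T := trivialTree) (fun _ => x.out.root)
      (fun m : Empty => m.elim) (fun n : Empty => n.elim)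
      ⟨fun _ _ _ => rfl, fun e => ⟨(), Subsingleton.elim _ _⟩⟩ (fun m : Empty => m.elim)
      (fun m : Empty => m.elim) fun n : Empty => n.elim⟩).symm
  · rintro rfl
    obtain ⟨α⟩ := cls_eq_iff.1 (rfl : cls trivialTree = _)
    exact ⟨fun n => (α.onN.symm n : Empty).elim⟩

lemma autCard_trivialTree : autCard (cls trivialTree) = 1 := by
  have : Subsingleton (EffTree.Iso trivialTree trivialTree) :=
    ⟨fun f g => EffTree.Iso.ext_onE fun _ => rfl⟩
  have : Subsingleton (Aut trivialTree) :=
    (Groupoid.isoEquivHom trivialTree trivialTree).injective.subsingleton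
  rw [autCard, card_aut_out, Nat.card_unique, Nat.cast_one]

lemma leafCount_trivialTree : leafCount (cls trivialTree) = 1 := by
  have h := (cls_trivialTree_iff _).2 rfl
  apply PNat.coe_injective
  have : (cls trivialTree).out.leaves = Set.univ :=
    Set.eq_univ_of_forall fun e ⟨n, _⟩ => h.elim n
  change Nat.card (cls trivialTree).out.leaves = 1
  rw [this, Nat.card_univ, card_E_of_isEmpty h]

/-- The restriction of power series to a single variable. -/
def toOneVar {σ : Type*} (i : σ) : MvPowerSeries σ ℚ →ₐ[ℚ] MvPowerSeries Unit ℚ :=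
  MvPowerSeries.killCompl ⟨fun _ => i, fun _ _ _ => rfl⟩

lemma coeff_toOneVar {σ : Type*} (i : σ) (f : MvPowerSeries σ ℚ) (k : ℕ) :
    MvPowerSeries.coeff (Finsupp.single () k) (toOneVar i f) =
      MvPowerSeries.coeff (Finsupp.single i k) f := by
  rw [toOneVar, MvPowerSeries.coeff_killCompl, Finsupp.embDomain_single]
  rfl

lemma toOneVar_linSeries {σ : Type*} (i : σ) (c : σ → ℚ) :
    toOneVar i (linSeries c) = c i • MvPowerSeries.X () := by
  refine MvPowerSeries.ext fun d => ?_
  obtain ⟨k, rfl⟩ : ∃ k : ℕ, d = Finsupp.single () k := ⟨d (), by ext; simp⟩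
  rw [coeff_toOneVar, MvPowerSeries.coeff_smul, MvPowerSeries.coeff_X]
  by_cases hk : k = 1
  · subst hk
    rw [coeff_linSeries_single, if_pos rfl, mul_one]
  · rw [if_neg fun h => hk (Finsupp.single_injective () h), mul_zero]
    by_contra h
    obtain ⟨j, hj, -⟩ := exists_of_coeff_linSeries h
    obtain ⟨rfl, h⟩ | ⟨-, h⟩ := (Finsupp.single_eq_single_iff _ _ _ _).1 hj
    · exact hk h
    · exact one_ne_zero h

/-- The trivial tree has one leaf and no non-trivial automorphism. -/
lemma toOneVar_phiGen (n : ℕ+) :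
    toOneVar (cls trivialTree) (phiGen n) = if n = 1 then MvPowerSeries.X () else 0 := by
  rw [phiGen_eq, toOneVar_linSeries, leafCount_trivialTree, autCard_trivialTree]
  by_cases h : n = 1
  · subst h
    simp
  · simp [h, Ne.symm h]

/-- Once all variables but the trivial tree are set to zero, `Φ` kills every `A_n` with `n ≠ 1` and
sends `A_1` to the remaining variable; only pure powers of `A_1` survive. -/
lemma coeff_single_Phi (f : FaaDiBruno) (k : ℕ) :
    MvPowerSeries.coeff (Finsupp.single (cls trivialTree) k) (Phi f) =
      MvPowerSeries.coeff (Finsupp.single 1 k) f := by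
  have h1 (j : ℕ) : toOneVar (cls trivialTree)
      ((Finsupp.single 1 j).prod fun n m => phiGen n ^ m) = MvPowerSeries.X () ^ j := by
    rw [Finsupp.prod_single_index (h := fun n m => phiGen n ^ m) (pow_zero _), map_pow, toOneVar_phiGen, if_pos rfl]
  rw [Phi, MvPowerSeries.substAlgHom_apply, MvPowerSeries.coeff_subst hasSubst_phiGen,
    finsum_eq_single _ (Finsupp.single 1 k)]
  · rw [← coeff_toOneVar (cls trivialTree), h1, MvPowerSeries.coeff_X_pow, if_pos rfl, smul_eq_mul, mul_one]
  · intro e he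
    rw [← coeff_toOneVar]
    by_cases h : ∃ n, n ≠ 1 ∧ e n ≠ 0
    · obtain ⟨n, hn, hne⟩ := h
      rw [Finsupp.prod, map_prod, Finset.prod_eq_zero (Finsupp.mem_support_iff.2 hne)]
      · simp
      · rw [map_pow, toOneVar_phiGen, if_neg hn, zero_pow hne]
    · push Not at h
      obtain ⟨j, rfl⟩ : ∃ j, e = Finsupp.single 1 j := by
        refine ⟨e 1, ?_⟩
        ext n
        by_cases hn : n = 1
        · subst hn
          simp
        · rw [h n hn, Finsupp.single_eq_of_ne hn]
      rw [h1, MvPowerSeries.coeff_X_pow, if_neg, smul_zero]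
      intro h
      exact he (by rw [Finsupp.single_injective () h])

lemma faaCounitGen_one : faaCounitGen 1 = 1 := by simp [faaCounitGen]

lemma faaCounitGen_of_ne {n : ℕ+} (h : n ≠ 1) : faaCounitGen n = 0 := by
  have : (n : ℕ) ≠ 1 := fun h' => h (PNat.coe_injective h')
  simp [faaCounitGen, PowerSeries.coeff_X, this]

lemma counitValue_Phi_iff (f : FaaDiBruno) (r : ℚ) :
    CounitValue faaCounitGen f r ↔ CounitValue treeCounitGen (Phi f) r := by
  rw [counitValue_iff 1 faaCounitGen_one fun _ => faaCounitGen_of_ne,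
    counitValue_iff (ε := treeCounitGen) (cls trivialTree) (if_pos ((cls_trivialTree_iff _).2 rfl))
      fun x hx => if_neg fun h => hx ((cls_trivialTree_iff x).1 h)]
  simp only [coeff_single_Phi]

lemma counitValue_coe {σ : Type*} (ε : σ → ℚ) (p : MvPolynomial σ ℚ) :
    CounitValue ε (p : MvPowerSeries σ ℚ) (MvPolynomial.aeval ε p) := by
  have h : (Function.support fun d : σ →₀ ℕ =>
      MvPowerSeries.coeff d (p : MvPowerSeries σ ℚ) * d.prod fun i k => ε i ^ k) ⊆
        p.support := by
    intro d hd
    have := left_ne_zero_of_mul hd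
    rw [MvPolynomial.coeff_coe] at this
    exact Finset.mem_coe.2 (MvPolynomial.mem_support_iff.2 this)
  refine ⟨p.support.finite_toSet.subset h, ?_⟩
  rw [finsum_eq_sum_of_support_subset _ h, MvPolynomial.aeval_def, MvPolynomial.eval₂_eq]
  refine Finset.sum_congr rfl fun d _ => ?_
  rw [MvPolynomial.coeff_coe]
  rfl

end Counit

end FdB

end

theorem mainTheorem7 :
    -- `Φ` is given by pullback along the leaf map: for every finite morphism of groupoids
    -- `q : X ⥤ FinSet`, it sends the relative cardinality of `q` to that of its pullback.
    (∀ (X : Type u) [Groupoid.{v} X] (q : X ⥤ FdB.FinSet), FdB.FiniteFibres q →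
      FdB.FiniteFibres (FdB.pullLeaf q) ∧
      FdB.Phi (FdB.linSeries fun n : ℕ+ => FdB.relCard q (FdB.cls (FdB.stdSet n))) =
        FdB.linSeries (FdB.relCard (FdB.pullLeaf q))) ∧
    -- values on the generators and on the total series
    (∀ n : ℕ+, FdB.Phi (FdB.bigA n) = FdB.bigG n) ∧
    (∀ n : ℕ+, FdB.Phi (FdB.smallA n) = FdB.smallG n) ∧
    FdB.Phi FdB.totalA = FdB.totalG ∧
    -- compatibility with the comultiplications
    (∀ f : FdB.FaaDiBruno, FdB.treeComul (FdB.Phi f) = FdB.PhiPhi (FdB.faaComul f)) ∧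
    -- compatibility with the counits, on polynomials and on all series that have a counit
    (∀ p : MvPolynomial ℕ+ ℚ, FdB.CounitValue FdB.treeCounitGen (FdB.Phi (p : FdB.FaaDiBruno))
      (MvPolynomial.aeval FdB.faaCounitGen p)) ∧
    (∀ (f : FdB.FaaDiBruno) (r : ℚ),
      FdB.CounitValue FdB.faaCounitGen f r ↔ FdB.CounitValue FdB.treeCounitGen (FdB.Phi f) r) := by
  refine ⟨fun X _ q hq => ⟨FdB.finiteFibres_pullback _ q hq, FdB.Phi_relCard q⟩,
    fun n => (FdB.Phi_bigA n).trans (FdB.bigG_eq n).symm, FdB.Phi_smallA, FdB.Phi_totalA,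
    FdB.treeComul_Phi, fun p => ?_, FdB.counitValue_Phi_iff⟩
  exact (FdB.counitValue_Phi_iff _ _).1 (FdB.counitValue_coe _ p)
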